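/- Let $r \ge 2$ be an integer and let $\varepsilon > 0$. For an integer $n \ge 0$ and $p \in (0,1]$ let $X = X_{r,n,p}$ be the number of copies of the star $K_{1,r}$ (that is, of subgraphs isomorphic to $K_{1,r}$) in the binomial random graph $G_{n,p}$ on $n$ vertices, in which each of the $\binom n2$ possible edges is present independently with probability $p$. Put $\mu := \mathbb{E} X$, and let $X_{r,n,1}$ be the number of copies of $K_{1,r}$ in the complete graph $K_n$. Set $$\Phi := \min\Bigl\{\mu,\ \max\bigl\{\mu^{1/r},\ \mu/n^{r-1}\bigr\}\,\log(1/p)\Bigr\}.$$ Then there are constants $c, C > 0$, depending only on $r$ and $\varepsilon$, such that for all $n$ and all $p \in (0,1]$ with $1 \le (1+\varepsilon)\mu \le X_{r,n,1}$ we have $\Pr(X \ge (1+\varepsilon)\mu) > 0$ and $$c\,\Phi \ \le\ -\log \Pr\bigl(X \ge (1+\varepsilon)\mu\bigr) \ \le\ C\,\Phi .$$ -/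

import Mathlib

/-- The number of copies of the star `K_{1,r}` in `G`: the number of (not necessarily induced)
subgraphs of `G` that are isomorphic to the complete bipartite graph `K_{1,r}`. -/
noncomputable def starCount (r : ℕ) {V : Type*} [Fintype V] (G : SimpleGraph V) : ℕ :=
  G.copyCount (completeBipartiteGraph (Fin 1) (Fin r))

/-- The expectation `μ = E X` of the number `X` of copies of `K_{1,r}` in the binomial random
graph `G(n,p)`. -/
noncomputable def starMean (r n : ℕ) (p : unitInterval) : ℝ :=
  ∫ G, (starCount r G : ℝ) ∂(SimpleGraph.binomialRandom (Fin n) p)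

/-- The probability `P(X ≥ x)`, where `X` is the number of copies of `K_{1,r}` in `G(n,p)`. -/
noncomputable def starUpperTail (r n : ℕ) (p : unitInterval) (x : ℝ) : ℝ :=
  (SimpleGraph.binomialRandom (Fin n) p).real {G | x ≤ (starCount r G : ℝ)}

/-- The exponent `Φ = min {μ, max {μ^{1/r}, μ / n^{r-1}} log (1/p)}`. -/
noncomputable def starRate (r n : ℕ) (p : unitInterval) : ℝ :=
  min (starMean r n p)
    (max (starMean r n p ^ (1 / (r : ℝ))) (starMean r n p / (n : ℝ) ^ (r - 1)) *
      Real.log (1 / (p : ℝ)))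

/-! Write `N = np`, `L = log(1/p)` and `K = min(μ^{1/r}, n)`. The maximum in `Φ` equals `μ /
K^{r-1}`, so `Φ = θμ` with `θ = min(1, L / K^{r-1})`. Moreover `X` is the sum of `C(deg v, r)` over
all vertices `v`.

Decay of the tail: cut the degrees at `D` of order `θ^{-1/(r-1)}`. A star whose centre has degree at
most `D` shares an edge with only `O(D^{r-1}) = O(1/θ)` others of this kind, so a moment argument
over edge-disjoint tuples (`binomialRandom_real_le_of_overlap_le`) gives `exp(-cθμ)` for these
stars. For larger degrees, split each degree into neighbours above and below in the vertex order.
Either family of half-degrees is independent, and one half is at least half the degree. Values may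
be truncated at `K`, since one value `μ^{1/r}` already yields order `μ` stars. A half-degree reaches
`k` with probability about `exp(-k log(k/N))`, while `θ min(k,K)^r` is at most of order `k log(k/N)`
(`mul_min_div_le_log`), so an exponential moment suffices (`binomialRandom_real_sum_truncPow_le`).

Lower bound on the tail: forcing one large star, or several vertices of full degree if one star does
not fit, costs `O(μ / K^{r-1})` edges, each with probability `p`
(`exists_exp_neg_le_starUpperTail`). If `N` is small, order `μ` stars with distinct centres appear
with probability `exp(-O(μ))` (`exists_exp_neg_starMean_le_starUpperTail`). If `N` is bounded below,
`Lμ / K^{r-1} = O(μ)`, so planting alone is enough (`mul_log_le_const_mul_starMean`). -/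

/-! ### Stars as pairs of a centre and a set of leaves. -/

open Finset in
/-- The pairs (centre, set of leaves) of the stars `K_{1,r}` contained in `G`. -/
noncomputable def starPairs {V : Type*} [Fintype V] (r : ℕ) (G : SimpleGraph V) :
    Finset (V × Finset V) := by
  classical exact {α | #α.2 = r ∧ ∀ u ∈ α.2, G.Adj α.1 u}

/-- The star with given centre and set of leaves, as a subgraph. -/
def starSubgraph {V : Type*} (G : SimpleGraph V) (α : V × Finset V)
    (h : ∀ u ∈ α.2, G.Adj α.1 u) : G.Subgraph where
  verts := insert α.1 (α.2 : Set V)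
  Adj x y := (x = α.1 ∧ y ∈ α.2) ∨ (y = α.1 ∧ x ∈ α.2)
  adj_sub := by
    rintro x y (⟨rfl, hy⟩ | ⟨rfl, hx⟩)
    · exact h _ hy
    · exact (h _ hx).symm
  edge_vert := by
    rintro x y (⟨rfl, hy⟩ | ⟨rfl, hx⟩)
    · exact Set.mem_insert _ _
    · exact Set.mem_insert_of_mem _ hx
  symm := ⟨fun x y h ↦ h.symm⟩

open Finset in
theorem mem_starPairs {V : Type*} [Fintype V] {r : ℕ} {G : SimpleGraph V} {α : V × Finset V} :
    α ∈ starPairs r G ↔ #α.2 = r ∧ ∀ u ∈ α.2, G.Adj α.1 u := by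
  classical
  simp [starPairs]

open Finset in
theorem starSubgraph_injective {V : Type*} [Fintype V] {r : ℕ} (hr : 2 ≤ r) {G : SimpleGraph V}
    {α β : V × Finset V} (hα : α ∈ starPairs r G) (hβ : β ∈ starPairs r G)
    (h : starSubgraph G α (mem_starPairs.1 hα).2 = starSubgraph G β (mem_starPairs.1 hβ).2) :
    α = β := by
  classical
  obtain ⟨v, S⟩ := α
  obtain ⟨w, T⟩ := β
  obtain ⟨hS, hS'⟩ := mem_starPairs.1 hα
  obtain ⟨hT, hT'⟩ := mem_starPairs.1 hβ
  dsimp only at hS hS' hT hT'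
  have key : ∀ x y, ((x = v ∧ y ∈ S) ∨ (y = v ∧ x ∈ S)) ↔ ((x = w ∧ y ∈ T) ∨ (y = w ∧ x ∈ T)) := by
    intro x y
    have := congrArg (fun K : G.Subgraph ↦ K.Adj x y) h
    simpa [starSubgraph] using this
  have hvS : v ∉ S := fun hv ↦ G.loopless.irrefl v (hS' v hv)
  have hwT : w ∉ T := fun hv ↦ G.loopless.irrefl w (hT' w hv)
  -- Two different centres would force a single leaf; this is where `r ≥ 2` is needed, since an edge
  -- has two possible centres.
  have hvw : v = w := by
    by_contra hne
    have : S ⊆ {w} := by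
      intro u hu
      rcases (key v u).1 (.inl ⟨rfl, hu⟩) with h1 | h1
      · exact absurd h1.1 hne
      · simp [h1.1]
    have := card_le_card this
    simp at this
    omega
  subst hvw
  have : S = T := by
    ext u
    constructor
    · intro hu
      rcases (key v u).1 (.inl ⟨rfl, hu⟩) with h1 | h1
      · exact h1.2
      · exact absurd h1.2 hwT
    · intro hu
      rcases (key v u).2 (.inl ⟨rfl, hu⟩) with h1 | h1
      · exact h1.2
      · exact absurd h1.2 hvS
  rw [this]

open Finset in
theorem starCount_eq_card {V : Type*} [Fintype V] {r : ℕ} (hr : 2 ≤ r) (G : SimpleGraph V) :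
    starCount r G = #(starPairs r G) := by
  classical
  let H := completeBipartiteGraph (Fin 1) (Fin r)
  rw [starCount, SimpleGraph.copyCount_eq_card_image_copyToSubgraph]
  let ψ : H.Copy G → V × Finset V := fun f ↦ (f (.inl 0), univ.image fun i ↦ f (.inr i))
  have hψ : ∀ f, ψ f ∈ starPairs r G := by
    intro f
    rw [mem_starPairs]
    refine ⟨?_, ?_⟩
    · simp only [ψ]
      rw [card_image_of_injective, card_univ, Fintype.card_fin]
      intro i j hij
      have := f.injective hij
      simpa using this
    · intro u hu
      simp only [ψ, mem_image, mem_univ, true_and] at hu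
      obtain ⟨i, rfl⟩ := hu
      exact f.toHom.map_adj (by simp [H])
  have hsub : ∀ f : H.Copy G, f.toSubgraph = starSubgraph G (ψ f) (mem_starPairs.1 (hψ f)).2 := by
    intro f
    ext x y
    · simp [starSubgraph, ψ, Set.range, Fin.exists_fin_one, eq_comm]
    · simp only [SimpleGraph.Copy.toSubgraph, SimpleGraph.Subgraph.map_adj, Relation.Map,
        starSubgraph, ψ]
      constructor
      · rintro ⟨a, b, hab, rfl, rfl⟩
        rcases a with a | a <;> rcases b with b | b
        · simp [H] at hab
        · left; simp [Subsingleton.elim a 0]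
        · right; simp [Subsingleton.elim b 0]
        · simp [H] at hab
      · simp only [mem_image, mem_univ, true_and]
        rintro (⟨rfl, b, rfl⟩ | ⟨rfl, b, rfl⟩)
        · exact ⟨.inl 0, .inr b, by simp [H], rfl, rfl⟩
        · exact ⟨.inr b, .inl 0, by simp [H], rfl, rfl⟩
  have hsurj : ∀ α ∈ starPairs r G, ∃ f, ψ f = α := by
    rintro ⟨v, S⟩ hα
    obtain ⟨hS, hadj⟩ := mem_starPairs.1 hα
    dsimp only at hS hadj
    have hvS : v ∉ S := fun hv ↦ G.loopless.irrefl v (hadj v hv)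
    let e : Fin r ≃ S := (Fintype.equivFinOfCardEq (by simpa using hS)).symm
    let g : Fin 1 ⊕ Fin r → V := Sum.elim (fun _ ↦ v) (fun i ↦ (e i : V))
    have hg : Function.Injective g := by
      rintro (a | a) (b | b) hab
      · simp [Subsingleton.elim a b]
      · exact absurd (show v ∈ S by rw [show v = e b from hab]; exact (e b).2) hvS
      · exact absurd (show v ∈ S by rw [← show (e a : V) = v from hab]; exact (e a).2) hvS
      · simpa [g, Subtype.ext_iff] using hab
    refine ⟨⟨⟨g, ?_⟩, hg⟩, ?_⟩
    · rintro (a | a) (b | b) hab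
      · simp [H] at hab
      · exact hadj _ (e b).2
      · exact (hadj _ (e a).2).symm
      · simp [H] at hab
    · refine Prod.ext rfl ?_
      ext u
      simp only [ψ, mem_image, mem_univ, true_and]
      constructor
      · rintro ⟨i, rfl⟩
        exact (e i).2
      · intro hu
        exact ⟨e.symm ⟨u, hu⟩, by
          change ((e (e.symm ⟨u, hu⟩) : S) : V) = u
          simp⟩
  symm
  refine card_bij (fun α hα ↦ starSubgraph G α (mem_starPairs.1 hα).2) ?_ ?_ ?_
  · intro α hα
    obtain ⟨f, rfl⟩ := hsurj α hα
    exact mem_image.2 ⟨f, mem_univ _, hsub f⟩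
  · intro α hα β hβ h
    exact starSubgraph_injective hr hα hβ h
  · intro K hK
    obtain ⟨f, -, rfl⟩ := mem_image.1 hK
    exact ⟨ψ f, hψ f, (hsub f).symm⟩

open Finset in
/-- The stars with centre in a set, counted by the degrees of the centres. -/
theorem card_starPairs_filter {V : Type*} [Fintype V] [DecidableEq V] (r : ℕ) (G : SimpleGraph V)
    [DecidableRel G.Adj] (P : V → Prop) [DecidablePred P] :
    #{α ∈ starPairs r G | P α.1} = ∑ v with P v, (G.degree v).choose r := by
  classical
  have : {α ∈ starPairs r G | P α.1} =
      (univ.filter P).biUnion fun v ↦ ((G.neighborFinset v).powersetCard r).image fun S ↦ (v, S) := by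
    ext ⟨v, S⟩
    simp only [mem_filter, mem_starPairs, mem_biUnion, mem_univ, true_and, mem_image,
      mem_powersetCard, Prod.mk.injEq]
    constructor
    · rintro ⟨⟨h1, h2⟩, h3⟩
      exact ⟨v, h3, S, ⟨fun u hu ↦ by simpa using h2 u hu, h1⟩, rfl, rfl⟩
    · rintro ⟨w, h3, T, ⟨h1, h2⟩, rfl, rfl⟩
      exact ⟨⟨h2, fun u hu ↦ by simpa using h1 hu⟩, h3⟩
  rw [this, card_biUnion]
  · refine sum_congr rfl fun v _ ↦ ?_
    rw [card_image_of_injective _ (Prod.mk_right_injective v), card_powersetCard,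
      SimpleGraph.card_neighborFinset_eq_degree]
  · intro v _ w _ hvw
    rw [Function.onFun, disjoint_left]
    intro α h1 h2
    simp only [mem_image] at h1 h2
    obtain ⟨_, _, rfl⟩ := h1
    obtain ⟨_, _, h⟩ := h2
    exact hvw (congrArg Prod.fst h).symm

open Finset in
theorem starCount_eq_sum {V : Type*} [Fintype V] [DecidableEq V] {r : ℕ} (hr : 2 ≤ r)
    (G : SimpleGraph V) [DecidableRel G.Adj] :
    starCount r G = ∑ v, (G.degree v).choose r := by
  classical
  have := card_starPairs_filter r G (fun _ ↦ True)
  simpa [← starCount_eq_card hr] using this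

/-! ### Independence of the edges and the mean of the star count. -/

open MeasureTheory ProbabilityTheory

instance SimpleGraph.instMeasurableSingletonClass {V : Type*} [Countable V] :
    MeasurableSingletonClass (SimpleGraph V) where
  measurableSet_singleton G := by
    have : ({G} : Set (SimpleGraph V)) = SimpleGraph.edgeSet ⁻¹' {G.edgeSet} := by
      ext H
      simp
    rw [this]
    exact SimpleGraph.measurable_edgeSet (measurableSet_singleton _)

/-- The Bernoulli distribution on `Prop`. -/
noncomputable def bernoulliProp (p : unitInterval) : Measure Prop :=
  unitInterval.toNNReal p • Measure.dirac True +
    unitInterval.toNNReal (unitInterval.symm p) • Measure.dirac False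

instance (p : unitInterval) : IsProbabilityMeasure (bernoulliProp p) := by
  constructor
  simp [bernoulliProp]

theorem bernoulliProp_true (p : unitInterval) :
    bernoulliProp p {True} = unitInterval.toNNReal p := by
  simp [bernoulliProp, Set.indicator]

/-- The indicators of distinct edges are independent Bernoulli variables. -/
theorem map_mem_edgeSet_binomialRandom {V ι : Type*} [Countable V] (p : unitInterval)
    {e : ι → Sym2 V} (he : Function.Injective e) (hd : ∀ i, ¬ (e i).IsDiag) :
    (SimpleGraph.binomialRandom V p).map (fun G i ↦ e i ∈ G.edgeSet) =
      Measure.infinitePi fun _ : ι ↦ bernoulliProp p := by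
  have hm : Measurable (fun (G : SimpleGraph V) (i : ι) ↦ e i ∈ G.edgeSet) := by
    refine measurable_pi_iff.2 fun i ↦ ?_
    exact (measurable_set_iff.1 SimpleGraph.measurable_edgeSet) (e i)
  have hm' : Measurable (fun ω : Sym2 V → Prop ↦ {i | ω i}) :=
    measurable_set_iff.2 fun i ↦ measurable_pi_apply i
  rw [SimpleGraph.binomialRandom_eq_map, setBernoulli_eq_map,
    Measure.map_map SimpleGraph.measurable_fromEdgeSet hm', Measure.map_map hm
      (SimpleGraph.measurable_fromEdgeSet.comp hm')]
  have : ((fun (G : SimpleGraph V) (i : ι) ↦ e i ∈ G.edgeSet) ∘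
      SimpleGraph.fromEdgeSet ∘ fun ω : Sym2 V → Prop ↦ {i | ω i}) = fun ω i ↦ ω (e i) := by
    funext ω i
    simp [hd i]
  rw [this]
  have : ∀ e : Sym2 V, IsProbabilityMeasure (unitInterval.toNNReal p •
      Measure.dirac (e ∈ (Sym2.diagSetᶜ : Set (Sym2 V))) +
      unitInterval.toNNReal (unitInterval.symm p) • Measure.dirac False) := by
    intro e
    constructor
    simp
  rw [Measure.map_infinitePi_infinitePi_of_inj he]
  congr 1
  funext i
  simp [bernoulliProp, hd i]

/-- The probability that all edges of a given set are present. -/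
theorem binomialRandom_real_subset {V : Type*} [Countable V] (p : unitInterval)
    (S : Finset (Sym2 V)) (hS : ∀ e ∈ S, ¬ e.IsDiag) :
    (SimpleGraph.binomialRandom V p).real {G | ∀ e ∈ S, e ∈ G.edgeSet} = (p : ℝ) ^ S.card := by
  have h := map_mem_edgeSet_binomialRandom p (e := ((↑) : S → Sym2 V)) Subtype.val_injective
    (fun i ↦ hS i i.2)
  have hm : Measurable (fun (G : SimpleGraph V) (i : S) ↦ (i : Sym2 V) ∈ G.edgeSet) := by
    refine measurable_pi_iff.2 fun i ↦ ?_
    exact (measurable_set_iff.1 SimpleGraph.measurable_edgeSet) (i : Sym2 V)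
  have h2 := congrArg (fun μ ↦ μ (Set.pi (Finset.univ : Finset S) fun _ ↦ {True})) h
  beta_reduce at h2
  rw [Measure.infinitePi_pi _ (fun _ _ ↦ measurableSet_singleton _), Measure.map_apply hm] at h2
  · simp only [bernoulliProp_true, Finset.prod_const, Finset.card_univ, Fintype.card_coe] at h2
    have h3 : {G : SimpleGraph V | ∀ e ∈ S, e ∈ G.edgeSet} =
        (fun (G : SimpleGraph V) (i : S) ↦ (i : Sym2 V) ∈ G.edgeSet) ⁻¹'
          (Set.pi (Finset.univ : Finset S) fun _ ↦ {True}) := by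
      ext G
      simp
    rw [measureReal_def, h3, h2]
    simp
  · exact MeasurableSet.pi (Set.to_countable _) fun _ _ ↦ measurableSet_singleton _

/-- The indicator of the event that all edges of `S` are present. -/
noncomputable def edgesIndicator {V : Type*} (S : Finset (Sym2 V)) (G : SimpleGraph V) : ℝ :=
  Set.indicator {G : SimpleGraph V | ∀ e ∈ S, e ∈ G.edgeSet} 1 G

theorem integral_edgesIndicator {V : Type*} [Finite V] (p : unitInterval)
    (S : Finset (Sym2 V)) (hS : ∀ e ∈ S, ¬ e.IsDiag) :
    ∫ G, edgesIndicator S G ∂(SimpleGraph.binomialRandom V p) = (p : ℝ) ^ S.card := by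
  rw [← binomialRandom_real_subset p S hS, ← integral_indicator_one (Set.toFinite _).measurableSet]
  rfl

open Classical in
theorem sum_edgesIndicator {V ι : Type*} (T : Finset ι) (S : ι → Finset (Sym2 V))
    (G : SimpleGraph V) :
    ∑ t ∈ T, edgesIndicator (S t) G = (T.filter fun t ↦ ∀ e ∈ S t, e ∈ G.edgeSet).card := by
  rw [Finset.card_filter]
  push_cast
  exact Finset.sum_congr rfl fun t _ ↦ by simp [edgesIndicator, Set.indicator]

/-- The edges of the star with given centre and set of leaves. -/
noncomputable def starEdges {V : Type*} (α : V × Finset V) : Finset (Sym2 V) :=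
  α.2.map ⟨fun u ↦ s(α.1, u), fun _ _ h ↦ Sym2.congr_right.1 h⟩

theorem mem_starEdges {V : Type*} {α : V × Finset V} {e : Sym2 V} :
    e ∈ starEdges α ↔ ∃ u ∈ α.2, s(α.1, u) = e := by
  simp only [starEdges, Finset.mem_map]
  rfl

theorem card_starEdges {V : Type*} (α : V × Finset V) : (starEdges α).card = α.2.card :=
  Finset.card_map _

theorem mem_starPairs_iff_edges {V : Type*} [Fintype V] {r : ℕ} {G : SimpleGraph V}
    {α : V × Finset V} :
    α ∈ starPairs r G ↔ α ∈ starPairs r ⊤ ∧ ∀ e ∈ starEdges α, e ∈ G.edgeSet := by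
  simp only [mem_starPairs, mem_starEdges, forall_exists_index, and_imp,
    forall_apply_eq_imp_iff₂, SimpleGraph.mem_edgeSet, SimpleGraph.top_adj]
  constructor
  · rintro ⟨h1, h2⟩
    exact ⟨⟨h1, fun u hu ↦ (h2 u hu).ne⟩, h2⟩
  · rintro ⟨⟨h1, -⟩, h2⟩
    exact ⟨h1, h2⟩

theorem not_isDiag_of_mem_starEdges {V : Type*} [Fintype V] {r : ℕ} {α : V × Finset V}
    (hα : α ∈ starPairs r ⊤) : ∀ e ∈ starEdges α, ¬ e.IsDiag := by
  intro e he
  obtain ⟨u, hu, rfl⟩ := mem_starEdges.1 he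
  simpa using (mem_starPairs.1 hα).2 u hu

theorem starCount_top {r : ℕ} (hr : 2 ≤ r) (n : ℕ) :
    starCount r (⊤ : SimpleGraph (Fin n)) = n * (n - 1).choose r := by
  classical
  rw [starCount_eq_sum hr]
  simp

theorem starCount_eq_sum_edgesIndicator {V : Type*} [Fintype V] {r : ℕ} (hr : 2 ≤ r)
    (G : SimpleGraph V) :
    (starCount r G : ℝ) = ∑ α ∈ starPairs r (⊤ : SimpleGraph V), edgesIndicator (starEdges α) G := by
  classical
  rw [starCount_eq_card hr, sum_edgesIndicator]
  congr 2
  ext α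
  simp only [Finset.mem_filter]
  exact mem_starPairs_iff_edges

theorem starMean_eq {r : ℕ} (hr : 2 ≤ r) (n : ℕ) (p : unitInterval) :
    starMean r n p = starCount r (⊤ : SimpleGraph (Fin n)) * (p : ℝ) ^ r := by
  rw [starCount_eq_card hr, starMean, funext fun G ↦ starCount_eq_sum_edgesIndicator hr G]
  rw [integral_finsetSum _ fun _ _ ↦ Integrable.of_finite]
  rw [Finset.sum_congr rfl fun α hα ↦ ?_, Finset.sum_const, nsmul_eq_mul]
  rw [integral_edgesIndicator p _ (not_isDiag_of_mem_starEdges hα), card_starEdges,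
    (mem_starPairs.1 hα).1]

/-! ### A moment bound for families of edge sets with bounded overlap. -/

open Finset in
/-- The `m`-tuples of elements of `s` for which the sets `e` are pairwise disjoint. -/
noncomputable def disjointTuples {ι κ : Type*} (e : ι → Finset κ) (s : Finset ι) (m : ℕ) :
    Finset (Fin m → ι) := by
  classical
  exact {t ∈ Fintype.piFinset fun _ ↦ s | ∀ i j, i ≠ j → Disjoint (e (t i)) (e (t j))}

theorem mem_disjointTuples {ι κ : Type*} {e : ι → Finset κ} {s : Finset ι} {m : ℕ}
    {t : Fin m → ι} : t ∈ disjointTuples e s m ↔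
      (∀ i, t i ∈ s) ∧ ∀ i j, i ≠ j → Disjoint (e (t i)) (e (t j)) := by
  classical
  simp [disjointTuples]

open Finset in
/-- The number of members of `s` whose set meets that of `β`. -/
noncomputable def overlapCount {ι κ : Type*} (e : ι → Finset κ) (s : Finset ι) (β : ι) : ℕ := by
  classical exact #{α ∈ s | ¬ Disjoint (e α) (e β)}

-- A tuple extends by any member of `s` that avoids its `m` entries, and each entry rules out at
-- most `C` members.
open Finset in
theorem card_disjointTuples_succ {ι κ : Type*} {e : ι → Finset κ} {s : Finset ι}
    {C : ℝ} (hC : ∀ β ∈ s, (overlapCount e s β : ℝ) ≤ C) (m : ℕ) :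
    (#(disjointTuples e s m) : ℝ) * (#s - m * C) ≤ #(disjointTuples e s (m + 1)) := by
  classical
  let bad : (Fin m → ι) → Finset ι := fun t ↦
    univ.biUnion fun i ↦ {α ∈ s | ¬ Disjoint (e α) (e (t i))}
  have hbad : ∀ t ∈ disjointTuples e s m, (#(bad t) : ℝ) ≤ m * C := by
    intro t ht
    calc (#(bad t) : ℝ) ≤ ((∑ i, #{α ∈ s | ¬ Disjoint (e α) (e (t i))} : ℕ) : ℝ) := by
          exact_mod_cast card_biUnion_le
      _ ≤ ∑ _i : Fin m, C := by
          rw [Nat.cast_sum]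
          exact sum_le_sum fun i _ ↦ hC _ ((mem_disjointTuples.1 ht).1 i)
      _ = m * C := by simp
  have hle : #((disjointTuples e s m).sigma fun t ↦ s \ bad t) ≤
      #(disjointTuples e s (m + 1)) := by
    refine card_le_card_of_injOn (fun x ↦ Fin.snoc (α := fun _ ↦ ι) x.1 x.2) ?_ ?_
    · rintro ⟨t, α⟩ h
      simp only [coe_sigma, Set.mem_sigma_iff, mem_coe, mem_sdiff] at h
      obtain ⟨ht, hα, hb⟩ := h
      obtain ⟨h1, h2⟩ := mem_disjointTuples.1 ht
      have h3 : ∀ i, Disjoint (e α) (e (t i)) := by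
        intro i
        by_contra hcon
        exact hb (mem_biUnion.2 ⟨i, mem_univ _, mem_filter.2 ⟨hα, hcon⟩⟩)
      rw [mem_coe, mem_disjointTuples]
      refine ⟨fun i ↦ ?_, fun i j ↦ ?_⟩
      · refine Fin.lastCases ?_ (fun i ↦ ?_) i
        · simpa using hα
        · simpa using h1 i
      · refine Fin.lastCases ?_ (fun i ↦ ?_) i <;> refine Fin.lastCases ?_ (fun j ↦ ?_) j
        · simp
        · exact fun _ ↦ by simpa using h3 j
        · exact fun _ ↦ by simpa using (h3 i).symm
        · intro hij
          simpa using h2 i j (by simpa using hij)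
    · rintro ⟨t, α⟩ - ⟨t', α'⟩ - h
      obtain ⟨h1, h2⟩ := Fin.snoc_injective2 h
      dsimp only at h1 h2
      rw [h1, h2]
  rw [card_sigma] at hle
  calc (#(disjointTuples e s m) : ℝ) * (#s - m * C)
      = ∑ _t ∈ disjointTuples e s m, ((#s : ℝ) - m * C) := by rw [sum_const, nsmul_eq_mul]
    _ ≤ ∑ t ∈ disjointTuples e s m, (#(s \ bad t) : ℝ) := by
        refine sum_le_sum fun t ht ↦ ?_
        have h1 := le_card_sdiff (bad t) s
        have h2 := hbad t ht
        have h3 : (#s : ℝ) ≤ #(s \ bad t) + #(bad t) := by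
          exact_mod_cast Nat.sub_le_iff_le_add.1 h1
        linarith
    _ ≤ _ := by exact_mod_cast hle

open Finset in
theorem prod_le_card_disjointTuples {ι κ : Type*} {e : ι → Finset κ} {s : Finset ι}
    {C : ℝ} (hC : ∀ β ∈ s, (overlapCount e s β : ℝ) ≤ C) {z : ℝ} (hz : z ≤ #s)
    (m : ℕ) (hm : ∀ i < m, 0 ≤ z - i * C) :
    ∏ i ∈ range m, (z - i * C) ≤ #(disjointTuples e s m) := by
  induction m with
  | zero =>
    have : (fun i : Fin 0 ↦ i.elim0) ∈ disjointTuples e s 0 :=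
      mem_disjointTuples.2 ⟨fun i ↦ i.elim0, fun i ↦ i.elim0⟩
    simpa using card_pos.2 ⟨_, this⟩
  | succ m ih =>
    rw [prod_range_succ]
    refine le_trans ?_ (card_disjointTuples_succ hC m)
    have h1 := hm m (by omega)
    exact mul_le_mul (ih fun i hi ↦ hm i (by omega)) (by linarith) h1 (by positivity)

-- Disjoint edge sets are present independently, so a tuple has probability equal to a product of
-- powers of `p`. Dropping the disjointness condition from the sum then gives a full `m`-th power.
open Finset in
theorem integral_card_disjointTuples_le {V ι : Type*} [Finite V] (p : unitInterval)
    {e : ι → Finset (Sym2 V)} {I : Finset ι} (hI : ∀ α ∈ I, ∀ x ∈ e α, ¬ x.IsDiag)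
    {J : SimpleGraph V → Finset ι} (hJI : ∀ G, J G ⊆ I)
    (hJ : ∀ G, ∀ α ∈ J G, ∀ x ∈ e α, x ∈ G.edgeSet) (m : ℕ) :
    ∫ G, (#(disjointTuples e (J G) m) : ℝ) ∂(SimpleGraph.binomialRandom V p) ≤
      (∑ α ∈ I, (p : ℝ) ^ #(e α)) ^ m := by
  classical
  have h1 : ∀ G, (#(disjointTuples e (J G) m) : ℝ) ≤ ∑ t ∈ disjointTuples e I m,
      edgesIndicator (univ.biUnion fun i ↦ e (t i)) G := by
    intro G
    rw [sum_edgesIndicator]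
    norm_cast
    refine card_le_card fun t ht ↦ ?_
    obtain ⟨ht1, ht2⟩ := mem_disjointTuples.1 ht
    refine mem_filter.2 ⟨mem_disjointTuples.2 ⟨fun i ↦ hJI G (ht1 i), ht2⟩, fun x hx ↦ ?_⟩
    obtain ⟨i, -, hi⟩ := mem_biUnion.1 hx
    exact hJ G _ (ht1 i) x hi
  calc _ ≤ ∫ G, (∑ t ∈ disjointTuples e I m,
      edgesIndicator (univ.biUnion fun i ↦ e (t i)) G)
        ∂(SimpleGraph.binomialRandom V p) :=
        integral_mono Integrable.of_finite Integrable.of_finite h1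
    _ = ∑ t ∈ disjointTuples e I m, ∏ i, (p : ℝ) ^ #(e (t i)) := by
        rw [integral_finsetSum _ fun _ _ ↦ Integrable.of_finite]
        refine sum_congr rfl fun t ht ↦ ?_
        obtain ⟨ht1, ht2⟩ := mem_disjointTuples.1 ht
        rw [integral_edgesIndicator, card_biUnion fun i _ j _ hij ↦ ht2 i j hij, prod_pow_eq_pow_sum]
        intro x hx
        obtain ⟨i, -, hi⟩ := mem_biUnion.1 hx
        exact hI _ (ht1 i) x hi
    _ ≤ ∑ t ∈ Fintype.piFinset fun _ : Fin m ↦ I, ∏ i, (p : ℝ) ^ #(e (t i)) := by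
        refine sum_le_sum_of_subset_of_nonneg ?_ ?_
        · intro t ht
          exact Fintype.mem_piFinset.2 (mem_disjointTuples.1 ht).1
        · intro t _ _
          have := p.2.1
          positivity
    _ = _ := by
        rw [sum_prod_piFinset I (fun (_ : Fin m) α ↦ (p : ℝ) ^ #(e α))]
        simp

open Finset in
/-- A Chernoff-type bound for the number of members of a family of present edge sets in which
every member meets at most `C` members. -/
theorem binomialRandom_real_le_of_overlap_le {V ι : Type*} [Finite V] (p : unitInterval)
    {e : ι → Finset (Sym2 V)} {I : Finset ι} (hI : ∀ α ∈ I, ∀ x ∈ e α, ¬ x.IsDiag)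
    {J : SimpleGraph V → Finset ι} (hJI : ∀ G, J G ⊆ I)
    (hJ : ∀ G, ∀ α ∈ J G, ∀ x ∈ e α, x ∈ G.edgeSet) {C : ℝ} (hC0 : 0 < C)
    (hC : ∀ G, ∀ β ∈ J G, (overlapCount e (J G) β : ℝ) ≤ C)
    {η : ℝ} (hη : 0 < η) {μ : ℝ} (hμ : μ = ∑ α ∈ I, (p : ℝ) ^ #(e α)) (hμ0 : 0 < μ) :
    (SimpleGraph.binomialRandom V p).real {G | (1 + η) * μ ≤ #(J G)} ≤
      Real.exp (-(η * Real.log (1 + η / 2) / 2 * (μ / C))) := by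
  -- With this `m`, every factor `(1 + η)μ - iC` with `i < m` stays above `(1 + η/2)μ`. Markov's
  -- inequality then compares `((1 + η/2)μ)^m` with the mean bound `μ^m`.
  obtain ⟨m, hm⟩ : ∃ m : ℕ, m = ⌈η * μ / (2 * C)⌉₊ := ⟨_, rfl⟩
  have hi : ∀ i < m, (1 + η / 2) * μ ≤ (1 + η) * μ - i * C := by
    intro i hi
    have h := Nat.lt_ceil.1 (hm ▸ hi)
    rw [lt_div_iff₀ (by positivity)] at h
    nlinarith
  set P := (SimpleGraph.binomialRandom V p)
  have hpos : 0 < (1 + η / 2) * μ := by positivity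
  have hmono : P.real {G | (1 + η) * μ ≤ #(J G)} ≤
      P.real {G | ((1 + η / 2) * μ) ^ m ≤ (#(disjointTuples e (J G) m) : ℝ)} := by
    refine measureReal_mono fun G hG ↦ ?_
    rw [Set.mem_ofPred_eq] at hG ⊢
    refine le_trans ?_ (prod_le_card_disjointTuples (hC G) hG m fun i h ↦ hpos.le.trans (hi i h))
    calc ((1 + η / 2) * μ) ^ m = ∏ _i ∈ range m, ((1 + η / 2) * μ) := by
          rw [prod_const, card_range]
      _ ≤ _ := prod_le_prod (fun _ _ ↦ hpos.le) fun i h ↦ hi i (mem_range.1 h)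
  have hmark : ((1 + η / 2) * μ) ^ m * P.real {G | (1 + η) * μ ≤ #(J G)} ≤ μ ^ m := by
    refine (mul_le_mul_of_nonneg_left hmono (pow_nonneg hpos.le m)).trans ?_
    refine le_trans (mul_meas_ge_le_integral_of_nonneg (.of_forall fun _ ↦ Nat.cast_nonneg _)
      Integrable.of_finite _) ?_
    rw [hμ]
    exact integral_card_disjointTuples_le p hI hJI hJ m
  have h2 : (1 + η / 2) ^ m * P.real {G | (1 + η) * μ ≤ #(J G)} ≤ 1 := by
    rw [mul_pow, mul_assoc, mul_left_comm] at hmark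
    have := pow_pos hμ0 m
    exact le_of_mul_le_mul_left (by linarith) this
  have h3 : Real.exp (η * Real.log (1 + η / 2) / 2 * (μ / C)) ≤ (1 + η / 2) ^ m := by
    rw [← Real.rpow_natCast, Real.rpow_def_of_pos (by positivity)]
    refine Real.exp_le_exp.2 ?_
    have := Nat.le_ceil (η * μ / (2 * C))
    rw [← hm] at this
    have hl : 0 ≤ Real.log (1 + η / 2) := Real.log_nonneg (by linarith)
    calc _ = Real.log (1 + η / 2) * (η * μ / (2 * C)) := by field_simp
      _ ≤ _ := mul_le_mul_of_nonneg_left this hl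
  rw [Real.exp_neg, ← one_div, le_div_iff₀ (Real.exp_pos _), mul_comm]
  exact (mul_le_mul_of_nonneg_right h3 measureReal_nonneg).trans h2

/-! ### Exponential moments of the degrees in an orientation. -/

open Finset in
open Classical in
/-- The number of neighbours of `v` in `R v`. -/
noncomputable def degreeIn {V : Type*} (R : V → Finset V) (G : SimpleGraph V) (v : V) : ℕ :=
  #{u ∈ R v | G.Adj v u}

theorem edgesIndicator_biUnion {V ι : Type*} [DecidableEq (Sym2 V)] (s : Finset ι)
    (S : ι → Finset (Sym2 V)) (G : SimpleGraph V) :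
    edgesIndicator (s.biUnion S) G = ∏ i ∈ s, edgesIndicator (S i) G := by
  classical
  have h : ∀ T : Finset (Sym2 V), edgesIndicator T G =
      if ∀ e ∈ T, e ∈ G.edgeSet then 1 else 0 := by
    intro T
    simp [edgesIndicator, Set.indicator]
  simp only [h]
  rw [Finset.prod_ite_zero]
  simp only [Finset.prod_const_one, Finset.mem_biUnion]
  congr 1
  refine propext ⟨fun H i hi e he ↦ H e ⟨i, hi, he⟩, ?_⟩
  rintro H e ⟨i, hi, he⟩
  exact H i hi e he

/-- By `hR'` each edge is assigned to at most one of its ends, which is what makes the degrees in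
`R` independent. -/
theorem starEdges_disjoint {V : Type*} {R : V → Finset V}
    (hR' : ∀ v, ∀ u ∈ R v, v ∉ R u) {v w : V} (hvw : v ≠ w) {S T : Finset V} (hS : S ⊆ R v)
    (hT : T ⊆ R w) : Disjoint (starEdges (v, S)) (starEdges (w, T)) := by
  rw [Finset.disjoint_left]
  intro e h1 h2
  obtain ⟨u, hu, rfl⟩ := mem_starEdges.1 h1
  obtain ⟨u', hu', h⟩ := mem_starEdges.1 h2
  dsimp only at hu hu' h
  rcases Sym2.eq_iff.1 h with ⟨h3, -⟩ | ⟨rfl, rfl⟩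
  · exact hvw h3.symm
  · exact hR' _ _ (hS hu) (hT hu')

open Finset in
theorem sum_powerset_edgesIndicator {V : Type*} (R : V → Finset V) (G : SimpleGraph V) (v : V)
    (w : ℕ → ℝ) :
    ∑ S ∈ (R v).powerset, w #S * edgesIndicator (starEdges (v, S)) G =
      ∑ k ∈ range (degreeIn R G v + 1), (degreeIn R G v).choose k * w k := by
  classical
  have h : ∀ S ∈ (R v).powerset, w #S * edgesIndicator (starEdges (v, S)) G =
      if S ⊆ {u ∈ R v | G.Adj v u} then w #S else 0 := by
    intro S hS
    rw [mem_powerset] at hS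
    have : (∀ e ∈ starEdges (v, S), e ∈ G.edgeSet) ↔ S ⊆ {u ∈ R v | G.Adj v u} := by
      simp only [mem_starEdges, forall_exists_index, and_imp,
        forall_apply_eq_imp_iff₂, SimpleGraph.mem_edgeSet]
      exact ⟨fun H u hu ↦ mem_filter.2 ⟨hS hu, H u hu⟩, fun H u hu ↦ (mem_filter.1 (H hu)).2⟩
    simp only [edgesIndicator, Set.indicator, Set.mem_ofPred_eq, this]
    split_ifs <;> simp
  rw [sum_congr rfl h, ← sum_filter]
  have h2 : (R v).powerset.filter (fun S ↦ S ⊆ ({u ∈ R v | G.Adj v u} : Finset V)) =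
      ({u ∈ R v | G.Adj v u} : Finset V).powerset := by
    ext S
    simp only [mem_filter, mem_powerset]
    exact ⟨fun H ↦ H.2, fun H ↦ ⟨H.trans (filter_subset _ _), H⟩⟩
  rw [h2, sum_powerset_apply_card w, degreeIn]
  simp

-- Expanding the product over the vertices gives indicators of unions of edge-disjoint stars, so the
-- expectation factorises over the vertices, with `C(degree, k)` replaced by `C(#(R v), k) p^k`.
open Finset in
theorem integral_prod_degreeIn {V : Type*} [Fintype V] (p : unitInterval) {R : V → Finset V}
    (hR : ∀ v, v ∉ R v) (hR' : ∀ v, ∀ u ∈ R v, v ∉ R u) (w : ℕ → ℝ) :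
    ∫ G, ∏ v, ∑ k ∈ range (degreeIn R G v + 1), (degreeIn R G v).choose k * w k
      ∂(SimpleGraph.binomialRandom V p) =
    ∏ v, ∑ k ∈ range (#(R v) + 1), (#(R v)).choose k * (w k * (p : ℝ) ^ k) := by
  classical
  have h1 : ∀ G : SimpleGraph V,
      ∏ v, ∑ k ∈ range (degreeIn R G v + 1), (degreeIn R G v).choose k * w k =
      ∑ S ∈ Fintype.piFinset fun v ↦ (R v).powerset, (∏ v, w #(S v)) *
        edgesIndicator (univ.biUnion fun v ↦ starEdges (v, S v)) G := by
    intro G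
    simp_rw [← sum_powerset_edgesIndicator, prod_univ_sum, prod_mul_distrib,
      edgesIndicator_biUnion]
  have h2 : ∀ v, ∑ k ∈ range (#(R v) + 1), (#(R v)).choose k * (w k * (p : ℝ) ^ k) =
      ∑ S ∈ (R v).powerset, w #S * (p : ℝ) ^ #S := by
    intro v
    rw [sum_powerset_apply_card fun k ↦ w k * (p : ℝ) ^ k]
    simp
  rw [funext h1, integral_finsetSum _ fun _ _ ↦ Integrable.of_finite]
  simp_rw [h2, prod_univ_sum]
  refine sum_congr rfl fun S hS ↦ ?_
  have hS' : ∀ v, S v ⊆ R v := fun v ↦ mem_powerset.1 (Fintype.mem_piFinset.1 hS v)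
  rw [integral_const_mul, integral_edgesIndicator, card_biUnion, prod_mul_distrib,
    prod_pow_eq_pow_sum]
  · simp [card_starEdges]
  · intro v _ v' _ hvv'
    exact starEdges_disjoint hR' hvv' (hS' v) (hS' v')
  · intro e he
    obtain ⟨v, -, hv⟩ := mem_biUnion.1 he
    obtain ⟨u, hu, rfl⟩ := mem_starEdges.1 hv
    rw [Sym2.mk_isDiag_iff]
    intro hvu
    dsimp only at hvu hu
    exact hR v (hvu ▸ hS' v hu)

open Finset in
/-- An exponential moment bound for functions of the degrees in an orientation. -/
theorem binomialRandom_real_sum_degreeIn_le {V : Type*} [Fintype V] (p : unitInterval)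
    {R : V → Finset V} (hR : ∀ v, v ∉ R v) (hR' : ∀ v, ∀ u ∈ R v, v ∉ R u) {w h : ℕ → ℝ}
    (hw0 : w 0 = 1) (hw : ∀ k, 0 ≤ w k) (hh : ∀ k, h k ≤ 0 ∨ Real.exp (h k) ≤ w k) {B : ℝ}
    (hB : ∀ v, ∑ k ∈ range (#(R v) + 1), (#(R v)).choose k * (w k * (p : ℝ) ^ k) ≤ 1 + B)
    (t : ℝ) :
    (SimpleGraph.binomialRandom V p).real {G | t ≤ ∑ v, h (degreeIn R G v)} ≤
      Real.exp (-t + Fintype.card V * B) := by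
  -- A single term of the nonnegative sum suffices: `k = 0` if `h y ≤ 0`, and `k = y` otherwise.
  have h1 : ∀ y : ℕ, Real.exp (h y) ≤ ∑ k ∈ range (y + 1), y.choose k * w k := by
    intro y
    have hnn : ∀ k ∈ range (y + 1), 0 ≤ y.choose k * w k :=
      fun k _ ↦ mul_nonneg (Nat.cast_nonneg _) (hw k)
    rcases hh y with hy | hy
    · calc Real.exp (h y) ≤ y.choose 0 * w 0 := by simpa [hw0] using hy
        _ ≤ _ := single_le_sum hnn (mem_range.2 (by omega))
    · calc Real.exp (h y) ≤ y.choose y * w y := by simpa using hy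
        _ ≤ _ := single_le_sum hnn (mem_range.2 (by omega))
  have h2 : Real.exp t * (SimpleGraph.binomialRandom V p).real
      {G | Real.exp t ≤ ∏ v, ∑ k ∈ range (degreeIn R G v + 1), (degreeIn R G v).choose k * w k} ≤
      ∏ v, ∑ k ∈ range (#(R v) + 1), (#(R v)).choose k * (w k * (p : ℝ) ^ k) := by
    rw [← integral_prod_degreeIn p hR hR' w]
    exact mul_meas_ge_le_integral_of_nonneg (.of_forall fun G ↦ prod_nonneg fun v _ ↦
      (Real.exp_pos _).le.trans (h1 _)) Integrable.of_finite _
  have h3 : (SimpleGraph.binomialRandom V p).real {G | t ≤ ∑ v, h (degreeIn R G v)} ≤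
      (SimpleGraph.binomialRandom V p).real
      {G | Real.exp t ≤ ∏ v, ∑ k ∈ range (degreeIn R G v + 1),
        (degreeIn R G v).choose k * w k} := by
    refine measureReal_mono fun G hG ↦ ?_
    rw [Set.mem_ofPred_eq] at hG ⊢
    refine (Real.exp_le_exp.2 hG).trans ?_
    rw [Real.exp_sum]
    exact prod_le_prod (fun _ _ ↦ (Real.exp_pos _).le) fun v _ ↦ h1 _
  have h4 : ∏ v, ∑ k ∈ range (#(R v) + 1), (#(R v)).choose k * (w k * (p : ℝ) ^ k) ≤
      Real.exp (Fintype.card V * B) := by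
    calc _ ≤ ∏ _v : V, Real.exp B := by
          refine prod_le_prod (fun v _ ↦ sum_nonneg fun k _ ↦ ?_) fun v _ ↦ (hB v).trans ?_
          · exact mul_nonneg (Nat.cast_nonneg _) (mul_nonneg (hw k) (pow_nonneg p.2.1 k))
          · linarith [Real.add_one_le_exp B]
      _ = _ := by rw [prod_const, card_univ, ← Real.exp_nat_mul]
  rw [Real.exp_add, Real.exp_neg, ← div_eq_inv_mul, le_div_iff₀ (Real.exp_pos _), mul_comm]
  exact (mul_le_mul_of_nonneg_left h3 (Real.exp_pos _).le).trans (h2.trans h4)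

/-! ### Stars with centres of low degree. -/

open Finset in
/-- The stars in `G` whose centres have degree at most `D`. -/
noncomputable def lowStarPairs {V : Type*} [Fintype V] (r : ℕ) (D : ℝ) (G : SimpleGraph V) :
    Finset (V × Finset V) := by
  classical exact {α ∈ starPairs r G | (G.degree α.1 : ℝ) ≤ D}

theorem mem_lowStarPairs {V : Type*} [Fintype V] {r : ℕ} {D : ℝ} {G : SimpleGraph V}
    [DecidableRel G.Adj] {α : V × Finset V} :
    α ∈ lowStarPairs r D G ↔ α ∈ starPairs r G ∧ (G.degree α.1 : ℝ) ≤ D := by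
  classical
  rw [lowStarPairs, Finset.mem_filter]
  convert! Iff.rfl

open Finset in
open Classical in
/-- The number of stars of `lowStarPairs` that use a given directed edge. -/
theorem card_lowStarPairs_filter_le {V : Type*} [Fintype V] {r : ℕ} {D : ℝ} (hD : 0 ≤ D)
    (G : SimpleGraph V) (v u : V) :
    (#{α ∈ lowStarPairs r D G | α.1 = v ∧ u ∈ α.2} : ℝ) ≤ D ^ (r - 1) := by
  by_cases hv : (G.degree v : ℝ) ≤ D
  · have hsub : {α ∈ lowStarPairs r D G | α.1 = v ∧ u ∈ α.2} ⊆
        ((G.neighborFinset v).powersetCard (r - 1)).image fun S ↦ (v, insert u S) := by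
      rintro ⟨w, S⟩ h
      simp only [mem_filter, mem_lowStarPairs, mem_starPairs] at h
      obtain ⟨⟨⟨h1, h2⟩, h3⟩, rfl, hu⟩ := h
      refine mem_image.2 ⟨S.erase u, mem_powersetCard.2 ⟨?_, ?_⟩, ?_⟩
      · intro x hx
        simpa using h2 x (mem_of_mem_erase hx)
      · rw [card_erase_of_mem hu, h1]
      · rw [insert_erase hu]
    have h1 := (card_le_card hsub).trans card_image_le
    rw [card_powersetCard, SimpleGraph.card_neighborFinset_eq_degree] at h1
    have h2 : (#{α ∈ lowStarPairs r D G | α.1 = v ∧ u ∈ α.2} : ℝ) ≤ (G.degree v : ℝ) ^ (r - 1) := by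
      exact_mod_cast h1.trans (Nat.choose_le_pow _ _)
    exact h2.trans (pow_le_pow_left₀ (Nat.cast_nonneg _) hv _)
  · have : {α ∈ lowStarPairs r D G | α.1 = v ∧ u ∈ α.2} = ∅ := by
      refine filter_eq_empty_iff.2 ?_
      rintro α h ⟨rfl, -⟩
      exact hv (mem_lowStarPairs.1 h).2
    rw [this]
    simpa using pow_nonneg hD _

-- A star meeting `β` contains one of the `r` edges of `β` and has its centre at one of the two ends
-- of that edge, hence the factor `2 * r`.
open Finset in
theorem overlapCount_lowStarPairs_le {V : Type*} [Fintype V] {r : ℕ} {D : ℝ} (hD : 0 ≤ D)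
    (G : SimpleGraph V) {β : V × Finset V} (hβ : β ∈ lowStarPairs r D G) :
    (overlapCount starEdges (lowStarPairs r D G) β : ℝ) ≤ 2 * r * D ^ (r - 1) := by
  classical
  let A : V → V → Finset (V × Finset V) := fun v u ↦
    {α ∈ lowStarPairs r D G | α.1 = v ∧ u ∈ α.2}
  have hsub : {α ∈ lowStarPairs r D G | ¬ Disjoint (starEdges α) (starEdges β)} ⊆
      β.2.biUnion fun u ↦ A β.1 u ∪ A u β.1 := by
    intro α hα
    obtain ⟨hα1, hα2⟩ := mem_filter.1 hα
    obtain ⟨e, he1, he2⟩ := Finset.not_disjoint_iff.1 hα2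
    obtain ⟨u, hu, rfl⟩ := mem_starEdges.1 he2
    obtain ⟨u', hu', h⟩ := mem_starEdges.1 he1
    refine mem_biUnion.2 ⟨u, hu, ?_⟩
    rw [mem_union]
    rcases Sym2.eq_iff.1 h with ⟨h3, rfl⟩ | ⟨h3, rfl⟩
    · exact .inl (mem_filter.2 ⟨hα1, h3, hu'⟩)
    · exact .inr (mem_filter.2 ⟨hα1, h3, hu'⟩)
  have h1 : (overlapCount starEdges (lowStarPairs r D G) β : ℝ) ≤
      ((∑ u ∈ β.2, #(A β.1 u ∪ A u β.1) : ℕ) : ℝ) := by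
    have h2 : overlapCount starEdges (lowStarPairs r D G) β =
        #{α ∈ lowStarPairs r D G | ¬ Disjoint (starEdges α) (starEdges β)} := by
      unfold overlapCount
      congr!
    rw [h2]
    exact Nat.cast_le.2 ((card_le_card hsub).trans card_biUnion_le)
  refine h1.trans ?_
  rw [Nat.cast_sum]
  have hcard : #β.2 = r := (mem_starPairs.1 (mem_lowStarPairs.1 hβ).1).1
  calc ∑ u ∈ β.2, (#(A β.1 u ∪ A u β.1) : ℝ) ≤ ∑ _u ∈ β.2, 2 * D ^ (r - 1) := by
        refine sum_le_sum fun u _ ↦ ?_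
        have h2 : (#(A β.1 u ∪ A u β.1) : ℝ) ≤ #(A β.1 u) + #(A u β.1) := by
          exact_mod_cast card_union_le _ _
        have h3 := card_lowStarPairs_filter_le (r := r) hD G β.1 u
        have h4 := card_lowStarPairs_filter_le (r := r) hD G u β.1
        simp only [A] at h2 ⊢
        linarith
    _ = _ := by rw [sum_const, hcard, nsmul_eq_mul]; ring

open Finset in
/-- The upper tail for the stars whose centres have degree at most `D`. -/
theorem binomialRandom_real_card_lowStarPairs_le {r n : ℕ} (hr : 2 ≤ r) (p : unitInterval)
    {D : ℝ} (hD : 0 < D) {η : ℝ} (hη : 0 < η) (hμ : 0 < starMean r n p) :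
    (SimpleGraph.binomialRandom (Fin n) p).real
      {G | (1 + η) * starMean r n p ≤ #(lowStarPairs r D G)} ≤
      Real.exp (-(η * Real.log (1 + η / 2) / 2 * (starMean r n p / (2 * r * D ^ (r - 1))))) := by
  classical
  refine binomialRandom_real_le_of_overlap_le p (e := starEdges) (I := starPairs r ⊤)
    (fun α hα ↦ not_isDiag_of_mem_starEdges hα)
    (fun G α hα ↦ (mem_starPairs_iff_edges.1 (mem_lowStarPairs.1 hα).1).1)
    (fun G α hα ↦ (mem_starPairs_iff_edges.1 (mem_lowStarPairs.1 hα).1).2) (by positivity)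
    (fun G β hβ ↦ overlapCount_lowStarPairs_le hD.le G hβ) hη ?_ hμ
  rw [starMean_eq hr, starCount_eq_card hr]
  rw [sum_congr rfl fun α hα ↦ by rw [card_starEdges, (mem_starPairs.1 hα).1], sum_const,
    nsmul_eq_mul]

/-! ### Splitting off the large degrees and truncating them. -/

/-- The power `y ^ r`, with small values removed and large values truncated. -/
noncomputable def truncPow (r : ℕ) (a K : ℝ) (y : ℕ) : ℝ :=
  if (y : ℝ) ≤ a then 0 else min (y : ℝ) K ^ r

/-- The larger part is at least `d / 2 > D / 2`, so its term survives the cutoff and alone dominates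
`d ^ r` up to `2 ^ r`. -/
theorem choose_le_of_add {r : ℕ} {D : ℝ} {d y z : ℕ} (hd : d = y + z) (hD : D < d) :
    (d.choose r : ℝ) ≤ 2 ^ r * ((if (y : ℝ) ≤ D / 2 then 0 else (y : ℝ) ^ r) +
      (if (z : ℝ) ≤ D / 2 then 0 else (z : ℝ) ^ r)) := by
  wlog hyz : z ≤ y generalizing y z
  · rw [add_comm]
    exact this (by omega) (by omega)
  have hdR : (d : ℝ) = y + z := by exact_mod_cast hd
  have hyz' : (z : ℝ) ≤ y := by exact_mod_cast hyz
  have h1 : (d.choose r : ℝ) ≤ (d : ℝ) ^ r := by exact_mod_cast Nat.choose_le_pow _ _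
  have h2 : (d : ℝ) ^ r ≤ 2 ^ r * (y : ℝ) ^ r := by
    rw [← mul_pow]
    exact pow_le_pow_left₀ (Nat.cast_nonneg _) (by linarith) _
  have h3 : (0 : ℝ) ≤ if (z : ℝ) ≤ D / 2 then 0 else (z : ℝ) ^ r := by
    split_ifs <;> positivity
  rw [if_neg (not_le.2 (by linarith : D / 2 < (y : ℝ)))]
  have : (0 : ℝ) ≤ 2 ^ r := by positivity
  nlinarith

open Finset in
/-- If the sum of `r`-th powers of large values is large, so is the truncated sum. -/
theorem le_sum_truncPow {ι : Type*} [Fintype ι] {r n : ℕ} (hr : r ≠ 0) {a μ δ : ℝ} (hμ : 0 ≤ μ)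
    (hδ : δ ≤ 1) {y : ι → ℕ} (hy : ∀ i, y i ≤ n)
    (h : δ * μ ≤ ∑ i, if (y i : ℝ) ≤ a then 0 else (y i : ℝ) ^ r) :
    δ * μ ≤ ∑ i, truncPow r a (min (μ ^ (1 / (r : ℝ))) n) (y i) := by
  have hroot : 0 ≤ μ ^ (1 / (r : ℝ)) := Real.rpow_nonneg hμ _
  have hnn : ∀ i, 0 ≤ truncPow r a (min (μ ^ (1 / (r : ℝ))) n) (y i) := by
    intro i
    rw [truncPow]
    split_ifs <;> positivity
  -- One value beyond `μ^{1/r}` still contributes `μ ≥ δμ` after truncation; if there is none,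
  -- truncation changes nothing, since all values are at most `n`.
  by_cases hbig : ∃ i, a < y i ∧ μ ^ (1 / (r : ℝ)) < y i
  · obtain ⟨i, h1, h2⟩ := hbig
    have h3 : μ ≤ truncPow r a (min (μ ^ (1 / (r : ℝ))) n) (y i) := by
      have h4 : (y i : ℝ) ≤ n := by exact_mod_cast hy i
      rw [truncPow, if_neg (not_le.2 h1), min_eq_left (h2.le.trans h4), min_eq_right h2.le,
        one_div, Real.rpow_inv_natCast_pow hμ hr]
    have h4 := single_le_sum (fun i _ ↦ hnn i) (mem_univ i)
    nlinarith
  · push Not at hbig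
    refine h.trans (sum_le_sum fun i _ ↦ ?_)
    rw [truncPow]
    split_ifs with h1
    · exact le_rfl
    · have h2 := hbig i (not_le.1 h1)
      have h4 : (y i : ℝ) ≤ n := by exact_mod_cast hy i
      rw [min_eq_left (le_min h2 h4)]

theorem degree_eq_add_degreeIn {n : ℕ} (G : SimpleGraph (Fin n)) [DecidableRel G.Adj]
    (v : Fin n) :
    G.degree v = degreeIn Finset.Ioi G v + degreeIn Finset.Iio G v := by
  classical
  rw [degreeIn, degreeIn, ← SimpleGraph.card_neighborFinset_eq_degree, ← Finset.card_union_of_disjoint]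
  · congr 1
    ext u
    simp only [SimpleGraph.mem_neighborFinset, Finset.mem_union, Finset.mem_filter,
      Finset.mem_Ioi, Finset.mem_Iio]
    constructor
    · intro h
      rcases lt_or_gt_of_ne h.ne with h1 | h1
      · exact .inl ⟨h1, h⟩
      · exact .inr ⟨h1, h⟩
    · rintro (h | h) <;> exact h.2
  · rw [Finset.disjoint_left]
    intro u h1 h2
    simp only [Finset.mem_filter, Finset.mem_Ioi, Finset.mem_Iio] at h1 h2
    exact lt_asymm h1.1 h2.1

theorem degreeIn_le {n : ℕ} (R : Fin n → Finset (Fin n)) (G : SimpleGraph (Fin n))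
    (v : Fin n) : degreeIn R G v ≤ n := by
  classical
  rw [degreeIn]
  exact (Finset.card_le_univ _).trans (by simp)

-- The excess `εμ` is shared out: half goes to the low centres, and the two half-degree sums,
-- multiplied by `2 ^ r`, get a quarter each.
open Finset in
theorem starCount_split {r n : ℕ} (hr : 2 ≤ r) {μ ε D : ℝ} (hμ : 0 ≤ μ) (hε : 0 < ε)
    (hε1 : ε ≤ 1) (G : SimpleGraph (Fin n)) (hG : (1 + ε) * μ ≤ starCount r G) :
    (1 + ε / 2) * μ ≤ #(lowStarPairs r D G) ∨
    ε / 2 ^ (r + 2) * μ ≤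
      ∑ v, truncPow r (D / 2) (min (μ ^ (1 / (r : ℝ))) n) (degreeIn Ioi G v) ∨
    ε / 2 ^ (r + 2) * μ ≤
      ∑ v, truncPow r (D / 2) (min (μ ^ (1 / (r : ℝ))) n) (degreeIn Iio G v) := by
  classical
  let H : ℕ → ℝ := fun y ↦ if (y : ℝ) ≤ D / 2 then 0 else (y : ℝ) ^ r
  have hδ : ε / 2 ^ (r + 2) ≤ 1 := by
    rw [div_le_one (by positivity)]
    exact hε1.trans (one_le_pow₀ (by norm_num))
  by_contra! hcon
  obtain ⟨h1, h2, h3⟩ := hcon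
  have h2' : ∑ v, H (degreeIn Ioi G v) < ε / 2 ^ (r + 2) * μ := by
    by_contra! h
    exact absurd (le_sum_truncPow (by omega) hμ hδ (degreeIn_le Ioi G) h) (not_le.2 h2)
  have h3' : ∑ v, H (degreeIn Iio G v) < ε / 2 ^ (r + 2) * μ := by
    by_contra! h
    exact absurd (le_sum_truncPow (by omega) hμ hδ (degreeIn_le Iio G) h) (not_le.2 h3)
  have h4 : (#(lowStarPairs r D G) : ℝ) =
      ∑ v with (G.degree v : ℝ) ≤ D, ((G.degree v).choose r : ℝ) := by
    have := card_starPairs_filter r G (fun v ↦ (G.degree v : ℝ) ≤ D)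
    rw [← Nat.cast_sum, ← this]
    congr 2
  have h5 : (starCount r G : ℝ) = #(lowStarPairs r D G) +
      ∑ v with ¬ (G.degree v : ℝ) ≤ D, ((G.degree v).choose r : ℝ) := by
    rw [h4, sum_filter_add_sum_filter_not, starCount_eq_sum hr]
    push_cast
    rfl
  have h6 : ∑ v with ¬ (G.degree v : ℝ) ≤ D, ((G.degree v).choose r : ℝ) ≤
      2 ^ r * (∑ v, H (degreeIn Ioi G v) + ∑ v, H (degreeIn Iio G v)) := by
    calc _ ≤ ∑ v with ¬ (G.degree v : ℝ) ≤ D,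
          2 ^ r * (H (degreeIn Ioi G v) + H (degreeIn Iio G v)) := by
          refine sum_le_sum fun v hv ↦ ?_
          exact choose_le_of_add (degree_eq_add_degreeIn G v) (not_le.1 (mem_filter.1 hv).2)
      _ ≤ ∑ v, 2 ^ r * (H (degreeIn Ioi G v) + H (degreeIn Iio G v)) := by
          refine sum_le_sum_of_subset_of_nonneg (filter_subset _ _) fun v _ _ ↦ ?_
          have : ∀ y, 0 ≤ H y := fun y ↦ by simp only [H]; split_ifs <;> positivity
          have h7 := this (degreeIn Ioi G v)
          have h8 := this (degreeIn Iio G v)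
          positivity
      _ = _ := by rw [← mul_sum, sum_add_distrib]
  have h7 : 2 ^ r * (ε / 2 ^ (r + 2) * μ + ε / 2 ^ (r + 2) * μ) = ε / 2 * μ := by
    rw [pow_add]
    field_simp
    ring
  have h8 : (0 : ℝ) < 2 ^ r := by positivity
  nlinarith

/-! ### Numerical estimates around the truncation scale. -/

theorem pow_le_const_mul_choose_pred {r n : ℕ} (hn : r + 1 ≤ n) :
    1 / ((r + 1 : ℝ) ^ r * r.factorial) * (n : ℝ) ^ r ≤ (n - 1).choose r := by
  have h1 : (((n - 1 + 1 - r : ℕ) : ℝ) ^ r) ≤ r.factorial * (n - 1).choose r := by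
    exact_mod_cast Nat.pow_sub_le_descFactorial (n - 1) r |>.trans_eq
      (Nat.descFactorial_eq_factorial_mul_choose _ _)
  have h2 : (n : ℝ) ≤ (r + 1) * ((n - 1 + 1 - r : ℕ) : ℝ) := by
    obtain ⟨m, rfl⟩ := Nat.exists_eq_add_of_le hn
    have : r + 1 + m - 1 + 1 - r = m + 1 := by omega
    rw [this]
    push_cast
    have : (0 : ℝ) ≤ r * m := by positivity
    nlinarith
  have h3 : (n : ℝ) ^ r ≤ (r + 1 : ℝ) ^ r * ((n - 1 + 1 - r : ℕ) : ℝ) ^ r := by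
    rw [← mul_pow]
    exact pow_le_pow_left₀ (Nat.cast_nonneg _) h2 _
  rw [div_mul_eq_mul_div, one_mul, div_le_iff₀ (by positivity)]
  calc (n : ℝ) ^ r ≤ _ := h3
    _ ≤ (r + 1 : ℝ) ^ r * (r.factorial * (n - 1).choose r) :=
        mul_le_mul_of_nonneg_left h1 (by positivity)
    _ = _ := by ring

/-- The truncation scale exceeds the mean degree `np` by a power of `1/p`: from `n²p ≥ m` one gets
`n ≥ m p^{-1/2}`, so `μ` is at least of order `p^{-1/2} (np)^r`. The bound on `n` only needs
`p^{-1/(2r)} ≤ 1/p`. -/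
theorem scale_lower_bound {r : ℕ} (hr : 1 ≤ r) {κ m n p μ : ℝ} (hκ : 0 < κ) (hκ1 : κ ≤ 1)
    (hm : 0 < m) (hm1 : m ≤ 1) (hp : 0 < p) (hp1 : p ≤ 1) (hn : 0 < n)
    (hμ : κ * (n * (n * p) ^ r) ≤ μ) (hnp : m ≤ n ^ 2 * p) :
    κ * m * (n * p) * Real.exp (Real.log (1 / p) / (2 * r)) ≤ min (μ ^ (1 / (r : ℝ))) n := by
  have hr0 : (0 : ℝ) < r := by exact_mod_cast hr
  set L := Real.log (1 / p)
  have hL : 0 ≤ L := Real.log_nonneg (by rw [le_div_iff₀ hp]; linarith)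
  have hE : Real.exp L = 1 / p := Real.exp_log (by positivity)
  have hq : Real.exp (L / (2 * r)) ^ r = Real.exp (L / 2) := by
    rw [← Real.exp_nat_mul]
    congr 1
    field_simp
  have hs : Real.exp (L / 2) ^ 2 * p = 1 := by
    rw [← Real.exp_nat_mul]
    rw [show ((2 : ℕ) : ℝ) * (L / 2) = L by push_cast; ring, hE]
    field_simp
  have hns : m * Real.exp (L / 2) ≤ n := by
    refine (sq_le_sq₀ (by positivity) hn.le).1 ?_
    have h1 : m ^ 2 ≤ m := by nlinarith
    have h2 : (m * Real.exp (L / 2)) ^ 2 * p ≤ n ^ 2 * p := by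
      calc (m * Real.exp (L / 2)) ^ 2 * p = m ^ 2 * (Real.exp (L / 2) ^ 2 * p) := by ring
        _ ≤ _ := by rw [hs]; linarith
    exact le_of_mul_le_mul_right h2 hp
  have hq0 := Real.exp_pos (L / (2 * r))
  refine le_min ?_ ?_
  · have hle : (κ * m * (n * p) * Real.exp (L / (2 * r))) ^ r ≤ μ := by
      refine le_trans ?_ hμ
      rw [mul_pow, mul_pow, hq]
      have h1 : (κ * m) ^ r ≤ κ * m :=
        pow_le_of_le_one (by positivity) (by nlinarith) (by omega)
      calc (κ * m) ^ r * (n * p) ^ r * Real.exp (L / 2)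
          ≤ κ * m * (n * p) ^ r * Real.exp (L / 2) := by gcongr
        _ = κ * ((m * Real.exp (L / 2)) * (n * p) ^ r) := by ring
        _ ≤ κ * (n * (n * p) ^ r) := by gcongr
    calc κ * m * (n * p) * Real.exp (L / (2 * r))
        = ((κ * m * (n * p) * Real.exp (L / (2 * r))) ^ r) ^ ((r : ℝ)⁻¹) :=
          (Real.pow_rpow_inv_natCast (by positivity) (by omega)).symm
      _ ≤ μ ^ (1 / (r : ℝ)) := by
          rw [one_div]
          exact Real.rpow_le_rpow (by positivity) hle (by positivity)
  · have h1 : Real.exp (L / (2 * r)) ≤ 1 / p := by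
      rw [← hE]
      refine Real.exp_le_exp.2 (div_le_self hL ?_)
      have : (1 : ℝ) ≤ r := by exact_mod_cast hr
      linarith
    have h2 : p * Real.exp (L / (2 * r)) ≤ 1 := by
      rw [le_div_iff₀ hp] at h1
      linarith
    have h3 : κ * m ≤ 1 := by nlinarith
    calc κ * m * (n * p) * Real.exp (L / (2 * r))
        = (κ * m) * n * (p * Real.exp (L / (2 * r))) := by ring
      _ ≤ 1 * n * 1 := by gcongr
      _ = n := by ring

/-- If `K` is much larger than `N`, then the logarithm of `k / N` is at least of order
`L * min k K / K`. -/
theorem mul_min_div_le_log {b c L N K k : ℝ} (hc : 0 < c) (hc1 : c ≤ 1) (hN : 0 < N)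
    (hK : c * N * Real.exp (b * L) ≤ K) (hk : Real.exp 1 * N ≤ k) :
    b / (1 + Real.log (1 / c)) * (L * (min k K / K)) ≤ Real.log (k / N) := by
  have hK0 : 0 < K := lt_of_lt_of_le (by positivity) hK
  have hlc : 0 ≤ Real.log (1 / c) := Real.log_nonneg (by rw [le_div_iff₀ hc]; linarith)
  have hx : Real.exp 1 ≤ k / N := by rwa [le_div_iff₀ hN]
  have hx0 : 0 < k / N := (Real.exp_pos 1).trans_le hx
  -- Since `log z ≥ 1`, the loss `log(1/c)` is absorbed into the factor `1 + log(1/c)`.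
  have key : ∀ z, Real.exp 1 ≤ z → c * Real.exp (b * L) ≤ z →
      b / (1 + Real.log (1 / c)) * L ≤ Real.log z := by
    intro z h1 h2
    have hz : 0 < z := (Real.exp_pos 1).trans_le h1
    have h3 : 1 ≤ Real.log z := by
      rw [← Real.log_exp 1]
      exact Real.log_le_log (Real.exp_pos 1) h1
    have h4 : Real.log c + b * L ≤ Real.log z := by
      rw [← Real.log_exp (b * L), ← Real.log_mul hc.ne' (Real.exp_pos _).ne']
      exact Real.log_le_log (by positivity) h2
    have h5 : Real.log (1 / c) = - Real.log c := by rw [one_div, Real.log_inv]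
    rw [div_mul_eq_mul_div, div_le_iff₀ (by positivity)]
    nlinarith
  have hy : c * Real.exp (b * L) ≤ K / N := by
    rw [le_div_iff₀ hN]
    linarith
  rcases le_total K k with h | h
  · rw [min_eq_right h, div_self hK0.ne', mul_one]
    exact key _ hx (hy.trans (by gcongr))
  · rw [min_eq_left h]
    have hxy : k / N ≤ K / N := by gcongr
    have h1 := key (K / N) (hx.trans hxy) hy
    -- `log x / x` decreases for `x ≥ e`, so the bound at `K` passes down to smaller `k` with the
    -- factor `k / K`.
    have h2 : Real.log (K / N) / (K / N) ≤ Real.log (k / N) / (k / N) :=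
      Real.log_div_self_antitoneOn hx (hx.trans hxy) hxy
    have hk0 : 0 < k := by
      have := (div_pos_iff_of_pos_right hN).1 hx0
      exact this
    calc b / (1 + Real.log (1 / c)) * (L * (k / K))
        = (b / (1 + Real.log (1 / c)) * L) * (k / K) := by ring
      _ ≤ Real.log (K / N) * (k / K) := by gcongr
      _ = Real.log (K / N) / (K / N) * (k / N) := by field_simp
      _ ≤ Real.log (k / N) / (k / N) * (k / N) := by gcongr
      _ = _ := by field_simp

/-- The exponential gap between `N` and `K` beats the factor `L`. Hence the cutoff `θ^{-1/(r-1)}` is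
at least of the order of the mean degree. -/
theorem mul_pow_le_of_scale {r : ℕ} (hr : 2 ≤ r) {b c L N K θ : ℝ} (hb : 0 < b) (hc : 0 < c)
    (hL : 0 ≤ L) (hN : 0 < N) (hK : c * N * Real.exp (b * L) ≤ K)
    (hθ : θ ≤ L / K ^ (r - 1)) : θ * N ^ (r - 1) ≤ 1 / (b * c ^ (r - 1)) := by
  have hK0 : 0 < K := lt_of_lt_of_le (by positivity) hK
  have h1 : (c * N * Real.exp (b * L)) ^ (r - 1) ≤ K ^ (r - 1) := by gcongr
  have h2 : Real.exp (b * L) ≤ Real.exp (b * L) ^ (r - 1) :=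
    le_self_pow₀ (Real.one_le_exp (by positivity)) (by omega)
  have h3 : b * L ≤ Real.exp (b * L) := by linarith [Real.add_one_le_exp (b * L)]
  have h4 : L * N ^ (r - 1) * (b * c ^ (r - 1)) ≤ K ^ (r - 1) := by
    calc L * N ^ (r - 1) * (b * c ^ (r - 1)) = c ^ (r - 1) * N ^ (r - 1) * (b * L) := by ring
      _ ≤ c ^ (r - 1) * N ^ (r - 1) * Real.exp (b * L) ^ (r - 1) := by
          gcongr
          exact h3.trans h2
      _ = (c * N * Real.exp (b * L)) ^ (r - 1) := by rw [mul_pow, mul_pow]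
      _ ≤ _ := h1
  rw [le_div_iff₀ (by positivity)]
  calc θ * N ^ (r - 1) * (b * c ^ (r - 1)) ≤
      L / K ^ (r - 1) * N ^ (r - 1) * (b * c ^ (r - 1)) := by gcongr
    _ = (L * N ^ (r - 1) * (b * c ^ (r - 1))) / K ^ (r - 1) := by ring
    _ ≤ 1 := by rw [div_le_one (by positivity)]; exact h4

/-- Extracting `C(m, r) p^r` makes the later error terms proportional to `μ` instead of `n`, which
matters when `μ` is much smaller than `n`. -/
theorem choose_mul_pow_le {r k m n : ℕ} (hmn : m ≤ n) (hrk : r ≤ k) {p : ℝ} (hp : 0 ≤ p) :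
    (m.choose k : ℝ) * p ^ k ≤
      m.choose r * p ^ r * ((n * p) ^ (k - r) / (k - r).factorial) := by
  have h1 : (m.choose k : ℝ) ≤ m.choose r * ((n : ℝ) ^ (k - r) / (k - r).factorial) := by
    rcases lt_or_ge m k with h | h
    · rw [Nat.choose_eq_zero_of_lt h]
      simp only [Nat.cast_zero]
      positivity
    have h2 : (m.choose k : ℝ) ≤ m.choose r * (m - r).choose (k - r) := by
      have := Nat.choose_mul (n := m) hrk
      have h3 : 0 < k.choose r := Nat.choose_pos hrk
      exact_mod_cast (Nat.le_mul_of_pos_right _ h3).trans_eq this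
    refine h2.trans (mul_le_mul_of_nonneg_left ?_ (Nat.cast_nonneg _))
    refine (Nat.choose_le_pow_div (k - r) (m - r)).trans ?_
    have : ((m - r : ℕ) : ℝ) ≤ n := by exact_mod_cast (Nat.sub_le _ _).trans hmn
    gcongr
  calc (m.choose k : ℝ) * p ^ k ≤
      m.choose r * ((n : ℝ) ^ (k - r) / (k - r).factorial) * p ^ k := by gcongr
    _ = _ := by
        rw [mul_pow, show p ^ k = p ^ r * p ^ (k - r) by rw [← pow_add]; congr 1; omega]
        ring

/-- Powers over factorials are super-exponentially small far beyond the maximum. -/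
theorem pow_div_factorial_le_exp_neg {r k : ℕ} (hr : 1 ≤ r) (hk : 2 * r ≤ k) {N : ℝ} (hN : 0 < N)
    (hx : Real.exp 16 * N ≤ k) :
    N ^ (k - r) / (k - r).factorial ≤ Real.exp (-(k / 4 * Real.log (k / N))) := by
  have hk0 : (0 : ℝ) < k := by
    have : 0 < k := by omega
    exact_mod_cast this
  obtain ⟨j, hj⟩ : ∃ j, j = k - r := ⟨_, rfl⟩
  rw [← hj]
  have hj2 : (k : ℝ) ≤ 2 * j := by
    have : k ≤ 2 * j := by omega
    exact_mod_cast this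
  have hj0 : (0 : ℝ) < j := by linarith
  have h1 := Real.pow_div_factorial_le_exp (x := (j : ℝ)) hj0.le j
  have hlog : 16 ≤ Real.log (k / N) := by
    rw [← Real.log_exp 16]
    refine Real.log_le_log (Real.exp_pos _) ?_
    rwa [le_div_iff₀ hN]
  have h2 : N ^ j / j.factorial ≤ Real.exp j * (N / j) ^ j := by
    calc N ^ j / j.factorial = ((j : ℝ) ^ j / j.factorial) * (N / j) ^ j := by
          rw [div_pow]
          field_simp
      _ ≤ _ := by gcongr
  refine h2.trans ?_
  have h3 : (N / j : ℝ) ≤ Real.exp (1 - Real.log (k / N)) := by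
    rw [Real.exp_sub, Real.exp_log (by positivity), div_le_div_iff₀ hj0 (by positivity)]
    have h4 : (2 : ℝ) ≤ Real.exp 1 := by
      linarith [Real.add_one_le_exp (1 : ℝ)]
    have h5 : N * (k / N) = k := by field_simp
    rw [h5]
    nlinarith
  calc Real.exp j * (N / j) ^ j ≤ Real.exp j * Real.exp (1 - Real.log (k / N)) ^ j := by gcongr
    _ = Real.exp (j * (2 - Real.log (k / N))) := by
        rw [← Real.exp_nat_mul, ← Real.exp_add]
        congr 1
        ring
    _ ≤ _ := by
        refine Real.exp_le_exp.2 ?_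
        nlinarith

theorem sum_exp_neg_le {a : ℝ} (s : Finset ℕ) (hs : ∀ k ∈ s, a ≤ k) :
    ∑ k ∈ s, Real.exp (-(2 * (k : ℝ))) ≤ 2 * Real.exp (-a) := by
  have he : Real.exp (-1) ≤ 1 / 2 := by
    rw [Real.exp_neg, ← one_div]
    exact one_div_le_one_div_of_le (by norm_num) (by linarith [Real.add_one_le_exp (1 : ℝ)])
  have h1 : ∀ k ∈ s, Real.exp (-(2 * (k : ℝ))) ≤ Real.exp (-a) * (1 / 2) ^ k := by
    intro k hk
    have h2 := hs k hk
    calc Real.exp (-(2 * (k : ℝ))) = Real.exp (-k) * Real.exp (-1) ^ k := by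
          rw [← Real.exp_nat_mul, ← Real.exp_add]
          congr 1
          ring
      _ ≤ _ := by gcongr
  calc _ ≤ ∑ k ∈ s, Real.exp (-a) * (1 / 2) ^ k := Finset.sum_le_sum h1
    _ = Real.exp (-a) * ∑ k ∈ s, (1 / 2 : ℝ) ^ k := by rw [Finset.mul_sum]
    _ ≤ Real.exp (-a) * 2 := by
        gcongr
        exact (summable_geometric_two.sum_le_tsum s fun k _ ↦ by positivity).trans_eq
          tsum_geometric_two
    _ = _ := by ring

/-! ### The contribution of the large degrees. -/

open Finset in
/-- The contribution of large values in an orientation is small with large probability. -/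
theorem binomialRandom_real_sum_truncPow_le {r n : ℕ} (hr : 2 ≤ r) {p : unitInterval} (hp : 0 < p)
    (hn : 0 < n) {R : Fin n → Finset (Fin n)} (hR : ∀ v, v ∉ R v) (hR' : ∀ v, ∀ u ∈ R v, v ∉ R u)
    {b c L K θ a : ℝ} (hb : 0 < b) (hc : 0 < c) (hc1 : c ≤ 1) (hθ : 0 < θ)
    (hK : c * (n * p) * Real.exp (b * L) ≤ K) (hθL : θ ≤ L / K ^ (r - 1))
    (har : 2 * r ≤ a) (haN : Real.exp 16 * (n * p) ≤ a) (t : ℝ) :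
    (SimpleGraph.binomialRandom (Fin n) p).real
      {G | t ≤ ∑ v, b / (1 + Real.log (1 / c)) / 8 * θ * truncPow r a K (degreeIn R G v)} ≤
      Real.exp (-t + n * (n - 1).choose r * (p : ℝ) ^ r * (2 * Real.exp (-a))) := by
  have hp0 : (0 : ℝ) < p := hp
  have hN : (0 : ℝ) < n * p := by positivity
  have hK0 : 0 < K := lt_of_lt_of_le (by positivity) hK
  have hlc : 0 ≤ Real.log (1 / c) := Real.log_nonneg (by rw [le_div_iff₀ hc]; linarith)
  obtain ⟨c', hc'⟩ : ∃ c', c' = b / (1 + Real.log (1 / c)) := ⟨_, rfl⟩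
  have hc'0 : 0 < c' := by rw [hc']; positivity
  rw [← hc']
  let h : ℕ → ℝ := fun k ↦ c' / 8 * θ * truncPow r a K k
  -- Values up to `a` have `h = 0` and are covered by the weight at `0`, so the weights between can
  -- vanish.
  let w : ℕ → ℝ := fun k ↦ if k = 0 then 1 else if (k : ℝ) ≤ a then 0 else Real.exp (h k)
  have hr0 : (0 : ℝ) < r := by
    have : 0 < r := by omega
    exact_mod_cast this
  have hterm : ∀ k : ℕ, a < k → ((n - 1).choose k : ℝ) * (Real.exp (h k) * (p : ℝ) ^ k) ≤
      (n - 1).choose r * (p : ℝ) ^ r * Real.exp (-(2 * (k : ℝ))) := by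
    intro k hk
    have hk0 : (0 : ℝ) < k := by linarith
    have hkr : 2 * r ≤ k := by
      have : ((2 * r : ℕ) : ℝ) ≤ k := by push_cast; linarith
      exact_mod_cast this
    have hkN : Real.exp 16 * (n * p) ≤ k := haN.trans hk.le
    have hkN1 : Real.exp 1 * (n * p) ≤ k := by
      refine le_trans ?_ hkN
      gcongr
      norm_num
    have h1 := choose_mul_pow_le (m := n - 1) (n := n) (Nat.sub_le _ _) (by omega : r ≤ k) hp0.le
    have h2 := pow_div_factorial_le_exp_neg (by omega : 1 ≤ r) hkr hN hkN
    have h3 := mul_min_div_le_log (b := b) hc hc1 hN hK hkN1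
    rw [← hc'] at h3
    -- This turns the final `exp(-(k/8) log(k/N))` into `exp(-2k)`.
    have hlog : 16 ≤ Real.log (k / (n * p)) := by
      rw [← Real.log_exp 16]
      refine Real.log_le_log (Real.exp_pos _) ?_
      rwa [le_div_iff₀ hN]
    -- The moment uses up half of the decay exponent `(k/4) log(k/N)`. As `r ≥ 2`, `(min k K /
    -- K)^{r-1} ≤ min k K / K`, which reduces the claim to `h3`.
    have h4 : h k ≤ k / 8 * Real.log (k / (n * p)) := by
      have hL : 0 ≤ L := by
        by_contra! hcon
        exact absurd hθL (not_le.2 ((div_neg_of_neg_of_pos hcon (by positivity)).trans hθ))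
      have hm0 : 0 ≤ min (k : ℝ) K := le_min hk0.le hK0.le
      have h5 : (min (k : ℝ) K / K) ^ (r - 1) ≤ min (k : ℝ) K / K :=
        pow_le_of_le_one (by positivity) (by rw [div_le_one hK0]; exact min_le_right _ _)
          (by omega)
      have h6 : min (k : ℝ) K ^ r = min (k : ℝ) K ^ (r - 1) * min (k : ℝ) K := by
        rw [← pow_succ]
        congr 1
        omega
      simp only [h]
      rw [truncPow, if_neg (not_le.2 hk), h6]
      calc c' / 8 * θ * (min (k : ℝ) K ^ (r - 1) * min (k : ℝ) K)
          ≤ c' / 8 * (L / K ^ (r - 1)) * (min (k : ℝ) K ^ (r - 1) * k) := by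
            gcongr
            exact min_le_left _ _
        _ = k / 8 * (c' * (L * (min (k : ℝ) K / K) ^ (r - 1))) := by rw [div_pow]; ring
        _ ≤ k / 8 * (c' * (L * (min (k : ℝ) K / K))) := by gcongr
        _ ≤ _ := by gcongr
    calc ((n - 1).choose k : ℝ) * (Real.exp (h k) * (p : ℝ) ^ k)
        = ((n - 1).choose k : ℝ) * (p : ℝ) ^ k * Real.exp (h k) := by ring
      _ ≤ ((n - 1).choose r * (p : ℝ) ^ r * ((n * p : ℝ) ^ (k - r) / (k - r).factorial)) *
          Real.exp (h k) := by gcongr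
      _ ≤ ((n - 1).choose r * (p : ℝ) ^ r * Real.exp (-(k / 4 * Real.log (k / (n * p))))) *
          Real.exp (k / 8 * Real.log (k / (n * p))) := by gcongr
      _ = (n - 1).choose r * (p : ℝ) ^ r * Real.exp (-(k / 8 * Real.log (k / (n * p)))) := by
          rw [mul_assoc, ← Real.exp_add]
          congr 2
          ring
      _ ≤ _ := by
          refine mul_le_mul_of_nonneg_left (Real.exp_le_exp.2 ?_) (by positivity)
          nlinarith
  have hB : ∀ v, ∑ k ∈ range (#(R v) + 1), ((#(R v)).choose k : ℝ) * (w k * (p : ℝ) ^ k) ≤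
      1 + (n - 1).choose r * (p : ℝ) ^ r * (2 * Real.exp (-a)) := by
    intro v
    have hcard : #(R v) ≤ n - 1 := by
      have : #(R v) < n := by
        have := card_lt_card (ssubset_univ_iff.2 (fun h ↦ hR v (h ▸ mem_univ v)) : R v ⊂ univ)
        simpa using this
      omega
    have h1 : ∀ k ∈ range (#(R v) + 1), ((#(R v)).choose k : ℝ) * (w k * (p : ℝ) ^ k) ≤
        (if k = 0 then (1 : ℝ) else 0) +
        (if a < (k : ℝ) then
          (n - 1).choose r * (p : ℝ) ^ r * Real.exp (-(2 * (k : ℝ))) else 0) := by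
      intro k _
      rcases eq_or_ne k 0 with rfl | hk
      · have : ¬ a < ((0 : ℕ) : ℝ) := by push_cast; linarith
        rw [if_neg this]
        simp [w]
      · rcases le_or_gt (k : ℝ) a with h2 | h2
        · simp [w, hk, h2, not_lt.2 h2]
        · simp only [w, if_neg hk, if_pos h2, if_neg (not_le.2 h2), zero_add]
          refine le_trans ?_ (hterm k h2)
          gcongr
    refine (sum_le_sum h1).trans ?_
    rw [sum_add_distrib]
    refine add_le_add (by simp) ?_
    rw [← sum_filter, ← mul_sum]
    gcongr
    exact sum_exp_neg_le _ fun k hk ↦ (mem_filter.1 hk).2.le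
  have hmain := binomialRandom_real_sum_degreeIn_le p hR hR' (w := w) (h := h) (by simp [w])
    (fun k ↦ by
      simp only [w]
      split_ifs <;> positivity)
    (fun k ↦ by
      rcases le_or_gt (k : ℝ) a with h2 | h2
      · left
        simp [h, truncPow, h2]
      · right
        have hk : k ≠ 0 := by
          rintro rfl
          push_cast at h2
          linarith
        simp [w, hk, not_le.2 h2]) hB t
  refine hmain.trans (Real.exp_le_exp.2 (le_of_eq ?_))
  rw [Fintype.card_fin]
  ring

/-! ### Assembling the upper bound on the tail. -/

/-- Both entries of the maximum have the form `μ / x^{r-1}`, with `x = μ^{1/r}` and `x = n`. -/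
theorem max_eq_div_min_pow {r : ℕ} (hr : 2 ≤ r) {μ n : ℝ} (hμ : 0 < μ) (hn : 0 < n) :
    max (μ ^ (1 / (r : ℝ))) (μ / n ^ (r - 1)) =
      μ / min (μ ^ (1 / (r : ℝ))) n ^ (r - 1) := by
  have hroot : 0 < μ ^ (1 / (r : ℝ)) := Real.rpow_pos_of_pos hμ _
  have h1 : μ / (μ ^ (1 / (r : ℝ))) ^ (r - 1) = μ ^ (1 / (r : ℝ)) := by
    rw [div_eq_iff (by positivity), ← pow_succ', show r - 1 + 1 = r by omega, one_div,
      Real.rpow_inv_natCast_pow hμ.le (by omega)]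
  rcases le_total (μ ^ (1 / (r : ℝ))) n with h | h
  · rw [min_eq_left h, h1, max_eq_left]
    rw [← h1]
    gcongr
  · rw [min_eq_right h, max_eq_right]
    nth_rw 1 [← h1]
    gcongr

theorem starMean_bounds {r n : ℕ} (hr : 2 ≤ r) {p : unitInterval} (hp : 0 < p)
    {m : ℝ} (hm : 0 < m) (hm1 : m ≤ 1) (hμ : m ≤ starMean r n p) :
    r + 1 ≤ n ∧ m ≤ (n : ℝ) ^ 2 * p ∧ starMean r n p ≤ n * (n * p : ℝ) ^ r ∧
      1 / ((r + 1 : ℝ) ^ r * r.factorial) * (n * (n * p : ℝ) ^ r) ≤ starMean r n p := by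
  have hp0 : (0 : ℝ) < p := hp
  have hmean : starMean r n p = n * (n - 1).choose r * (p : ℝ) ^ r := by
    rw [starMean_eq hr, starCount_top hr]
    push_cast
    ring
  have hn : r + 1 ≤ n := by
    by_contra! h
    rw [hmean] at hμ
    rcases Nat.eq_zero_or_pos n with rfl | h0
    · simp at hμ
      linarith
    · rw [Nat.choose_eq_zero_of_lt (by omega)] at hμ
      simp at hμ
      linarith
  have hn0 : (1 : ℝ) ≤ n := by
    have : 1 ≤ n := by omega
    exact_mod_cast this
  have hup : starMean r n p ≤ n * (n * p : ℝ) ^ r := by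
    rw [hmean, mul_pow]
    have : ((n - 1).choose r : ℝ) ≤ (n : ℝ) ^ r := by
      refine le_trans (by exact_mod_cast Nat.choose_le_pow (n - 1) r)
        (pow_le_pow_left₀ (Nat.cast_nonneg _) ?_ r)
      exact_mod_cast Nat.sub_le n 1
    calc _ ≤ (n : ℝ) * (n : ℝ) ^ r * (p : ℝ) ^ r := by gcongr
      _ = _ := by ring
  refine ⟨hn, ?_, hup, ?_⟩
  -- `μ ≤ n(np)^r ≤ (n²p)^r`, so a mean of at least `m` prevents `n²p` from being smaller than `m`.
  · by_contra! h
    have h1 : ((n : ℝ) ^ 2 * p) ^ r ≤ (n : ℝ) ^ 2 * p :=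
      pow_le_of_le_one (by positivity) (by linarith) (by omega)
    have h2 : (n : ℝ) * (n * p : ℝ) ^ r ≤ ((n : ℝ) ^ 2 * p) ^ r := by
      calc (n : ℝ) * (n * p : ℝ) ^ r ≤ (n : ℝ) ^ r * (n * p : ℝ) ^ r := by
            gcongr
            exact le_self_pow₀ hn0 (by omega)
        _ = _ := by rw [← mul_pow]; ring
    linarith
  · rw [hmean]
    have := pow_le_const_mul_choose_pred hn
    calc _ = n * (1 / ((r + 1 : ℝ) ^ r * r.factorial) * (n : ℝ) ^ r) * (p : ℝ) ^ r := by
          rw [mul_pow]; ring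
      _ ≤ _ := by gcongr

set_option maxHeartbeats 1000000 in
open Finset in
theorem exists_upperTail_le_three_mul_exp {r : ℕ} (hr : 2 ≤ r) {m η : ℝ} (hm : 0 < m) (hm1 : m ≤ 1)
    (hη : 0 < η) (hη1 : η ≤ 1) :
    ∃ c : ℝ, 0 < c ∧ ∀ (n : ℕ) (p : unitInterval), 0 < p → p < 1 → m ≤ starMean r n p →
      starUpperTail r n p ((1 + η) * starMean r n p) ≤ 3 * Real.exp (-(c * starRate r n p)) := by
  have hr2 : (2 : ℝ) ≤ r := by exact_mod_cast hr
  obtain ⟨κ, hκ⟩ : ∃ κ : ℝ, κ = 1 / ((r + 1 : ℝ) ^ r * r.factorial) := ⟨_, rfl⟩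
  have hκ0 : 0 < κ := by rw [hκ]; positivity
  have hκ1 : κ ≤ 1 := by
    rw [hκ, div_le_one (by positivity)]
    have h1 : (1 : ℝ) ≤ (r + 1 : ℝ) ^ r := one_le_pow₀ (by linarith)
    have h2 : (1 : ℝ) ≤ r.factorial := by exact_mod_cast Nat.succ_le_of_lt (Nat.factorial_pos r)
    nlinarith
  obtain ⟨c₁, hc₁⟩ : ∃ c₁, c₁ = κ * m := ⟨_, rfl⟩
  have hc₁0 : 0 < c₁ := by rw [hc₁]; positivity
  have hc₁1 : c₁ ≤ 1 := by rw [hc₁]; nlinarith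
  obtain ⟨b, hb⟩ : ∃ b : ℝ, b = 1 / (2 * r) := ⟨_, rfl⟩
  have hb0 : 0 < b := by rw [hb]; positivity
  have hb1 : b ≤ 1 := by
    rw [hb, div_le_one (by positivity)]
    linarith
  obtain ⟨c₃, hc₃⟩ : ∃ c₃, c₃ = b / (1 + Real.log (1 / c₁)) := ⟨_, rfl⟩
  have hlc : 0 ≤ Real.log (1 / c₁) := Real.log_nonneg (by rw [le_div_iff₀ hc₁0]; linarith)
  have hc₃0 : 0 < c₃ := by rw [hc₃]; positivity
  -- The moment bound offers the exponent `2dθμ`; half of it pays for the error term `μ *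
  -- 2exp(-As/2) ≤ dθμ`.
  obtain ⟨d, hd⟩ : ∃ d, d = c₃ / 8 * (η / 2 ^ (r + 2)) / 2 := ⟨_, rfl⟩
  have hd0 : 0 < d := by rw [hd]; positivity
  obtain ⟨c₆, hc₆⟩ : ∃ c₆, c₆ = 1 / (b * c₁ ^ (r - 1)) := ⟨_, rfl⟩
  have hc₆0 : 0 < c₆ := by rw [hc₆]; positivity
  have hc₆1 : 1 ≤ c₆ := by
    rw [hc₆, le_div_iff₀ (by positivity), one_mul]
    have := pow_le_one₀ (n := r - 1) hc₁0.le hc₁1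
    have h0 : 0 < c₁ ^ (r - 1) := by positivity
    nlinarith
  -- The three summands serve `har`, `haN` and `hexp` in turn.
  obtain ⟨A, hA⟩ : ∃ A, A = 4 * r + 2 * Real.exp 16 * c₆ + 2 ^ r * (r - 1).factorial / d :=
    ⟨_, rfl⟩
  have hA1 : 4 * r ≤ A := by
    rw [hA]
    have : 0 < 2 * Real.exp 16 * c₆ := by positivity
    have : 0 < 2 ^ r * (r - 1).factorial / d := by positivity
    linarith
  have hA2 : 2 * Real.exp 16 * c₆ ≤ A := by
    rw [hA]
    have : 0 < 2 ^ r * (r - 1).factorial / d := by positivity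
    linarith
  have hA3 : 2 ^ r * (r - 1).factorial / d ≤ A := by
    rw [hA]
    have : 0 < 2 * Real.exp 16 * c₆ := by positivity
    linarith
  clear hA
  have hA0 : 1 ≤ A := by linarith
  obtain ⟨ca, hca⟩ : ∃ ca, ca = (η / 2) * Real.log (1 + η / 2 / 2) / 2 / (2 * r * A ^ (r - 1)) :=
    ⟨_, rfl⟩
  have hca0 : 0 < ca := by
    rw [hca]
    have : 0 < Real.log (1 + η / 2 / 2) := Real.log_pos (by linarith)
    positivity
  refine ⟨min ca d, lt_min hca0 hd0, fun n p hp hp1 hmμ ↦ ?_⟩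
  have hp0 : (0 : ℝ) < p := hp
  have hp1' : (p : ℝ) < 1 := hp1
  have hμ0 : 0 < starMean r n p := hm.trans_le hmμ
  obtain ⟨hn, hnp, -, hlow⟩ := starMean_bounds hr hp hm hm1 hmμ
  have hn0 : 0 < n := by omega
  have hn0' : (0 : ℝ) < n := by exact_mod_cast hn0
  have hN : (0 : ℝ) < n * p := by positivity
  rw [← hκ] at hlow
  obtain ⟨μ, hμ⟩ : ∃ μ, μ = starMean r n p := ⟨_, rfl⟩
  obtain ⟨L, hL⟩ : ∃ L, L = Real.log (1 / p) := ⟨_, rfl⟩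
  have hL0 : 0 < L := by
    rw [hL]
    exact Real.log_pos (by rwa [lt_div_iff₀ hp0, one_mul])
  obtain ⟨K, hK⟩ : ∃ K, K = min (μ ^ (1 / (r : ℝ))) n := ⟨_, rfl⟩
  have hKlow : c₁ * (n * p) * Real.exp (b * L) ≤ K := by
    rw [hK, hc₁, hb, hL, hμ, div_mul_eq_mul_div, one_mul]
    exact scale_lower_bound (by omega) hκ0 hκ1 hm hm1 hp0 hp1'.le hn0' hlow hnp
  have hK0 : 0 < K := lt_of_lt_of_le (by positivity) hKlow
  rw [← hμ] at hμ0
  have hrate : starRate r n p = min μ (μ / K ^ (r - 1) * L) := by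
    rw [starRate, ← hμ, ← hL, max_eq_div_min_pow hr hμ0 hn0', ← hK]
  obtain ⟨θ, hθ⟩ : ∃ θ, θ = starRate r n p / μ := ⟨_, rfl⟩
  have hΦ : starRate r n p = θ * μ := by rw [hθ]; field_simp
  have hθ0 : 0 < θ := by
    rw [hθ, hrate]
    have : 0 < min μ (μ / K ^ (r - 1) * L) := lt_min hμ0 (by positivity)
    positivity
  have hθ1 : θ ≤ 1 := by
    rw [hθ, div_le_one hμ0, hrate]
    exact min_le_left _ _
  have hθL : θ ≤ L / K ^ (r - 1) := by
    rw [hθ, div_le_iff₀ hμ0, hrate]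
    exact (min_le_right _ _).trans_eq (by ring)
  -- The degree cutoff is `A * s`, chosen so that the overlap `2r(As)^{r-1}` is a constant over `θ`.
  obtain ⟨s, hs⟩ : ∃ s : ℝ, s = (1 / θ) ^ (((r - 1 : ℕ) : ℝ)⁻¹) := ⟨_, rfl⟩
  have hsr : s ^ (r - 1) = 1 / θ := by
    rw [hs, Real.rpow_inv_natCast_pow (by positivity) (by omega)]
  have hs1 : 1 ≤ s := by
    rw [hs]
    exact Real.one_le_rpow (by rw [le_div_iff₀ hθ0]; linarith) (by positivity)
  have hsN : (n * p : ℝ) ≤ c₆ * s := by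
    have h1 := mul_pow_le_of_scale hr hb0 hc₁0 hL0.le hN hKlow hθL
    rw [← hc₆] at h1
    refine (pow_le_pow_iff_left₀ hN.le (by positivity) (by omega : r - 1 ≠ 0)).1 ?_
    rw [mul_pow c₆, hsr, mul_one_div, le_div_iff₀ hθ0, mul_comm]
    exact h1.trans (le_self_pow₀ hc₆1 (by omega))
  have hD0 : 0 < A * s := by positivity
  have hDr : (A * s) ^ (r - 1) = A ^ (r - 1) / θ := by rw [mul_pow, hsr]; ring
  have har : 2 * r ≤ A * s / 2 := by
    have : A ≤ A * s := le_mul_of_one_le_right (by linarith) hs1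
    linarith
  have haN : Real.exp 16 * (n * p) ≤ A * s / 2 := by
    calc Real.exp 16 * (n * p) ≤ Real.exp 16 * (c₆ * s) :=
          mul_le_mul_of_nonneg_left hsN (Real.exp_pos 16).le
      _ = 2 * Real.exp 16 * c₆ * s / 2 := by ring
      _ ≤ A * s / 2 := by gcongr
  have hexp : 2 * Real.exp (-(A * s / 2)) ≤ d * θ := by
    have h1 := Real.pow_div_factorial_le_exp (x := A * s / 2) (by positivity) (r - 1)
    rw [div_pow, hDr] at h1
    have h2 : A ≤ A ^ (r - 1) := le_self_pow₀ hA0 (by omega)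
    have h3 : 2 ^ r * (r - 1).factorial / d ≤ A ^ (r - 1) := hA3.trans h2
    rw [Real.exp_neg, ← div_eq_mul_inv, div_le_iff₀ (Real.exp_pos _)]
    calc (2 : ℝ) = d * θ * ((2 ^ r * (r - 1).factorial / d) / θ / 2 ^ (r - 1) /
          (r - 1).factorial) := by
          rw [show (2 : ℝ) ^ r = 2 * 2 ^ (r - 1) by rw [← pow_succ']; congr 1; omega]
          have : ((r - 1).factorial : ℝ) ≠ 0 := by positivity
          field_simp
      _ ≤ d * θ * (A ^ (r - 1) / θ / 2 ^ (r - 1) / (r - 1).factorial) := by gcongr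
      _ ≤ _ := by gcongr
  have hpart : ∀ R : Fin n → Finset (Fin n), (∀ v, v ∉ R v) → (∀ v, ∀ u ∈ R v, v ∉ R u) →
      (SimpleGraph.binomialRandom (Fin n) p).real
        {G | η / 2 ^ (r + 2) * μ ≤ ∑ v, truncPow r (A * s / 2) K (degreeIn R G v)} ≤
      Real.exp (-(d * (θ * μ))) := by
    intro R hR hR'
    have h1 := binomialRandom_real_sum_truncPow_le hr hp hn0 hR hR' hb0 hc₁0 hc₁1 hθ0 hKlow hθL
      har haN (2 * d * θ * μ)
    rw [← hc₃] at h1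
    refine (measureReal_mono fun G hG ↦ ?_).trans (h1.trans (Real.exp_le_exp.2 ?_))
    · rw [Set.mem_ofPred_eq] at hG ⊢
      rw [← mul_sum]
      calc 2 * d * θ * μ = c₃ / 8 * θ * (η / 2 ^ (r + 2) * μ) := by rw [hd]; ring
        _ ≤ _ := by gcongr
    · have h2 : (n : ℝ) * (n - 1).choose r * (p : ℝ) ^ r = μ := by
        rw [hμ, starMean_eq hr, starCount_top hr]
        push_cast
        ring
      rw [h2]
      have := mul_le_mul_of_nonneg_left hexp hμ0.le
      linarith
  have hlowstars := binomialRandom_real_card_lowStarPairs_le hr p hD0 (half_pos hη)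
    (hμ ▸ hμ0 : 0 < starMean r n p)
  rw [← hμ] at hlowstars
  have hexp1 : η / 2 * Real.log (1 + η / 2 / 2) / 2 * (μ / (2 * r * (A * s) ^ (r - 1))) =
      ca * (θ * μ) := by
    rw [hDr, hca]
    field_simp
  rw [hexp1] at hlowstars
  have hIoi := hpart Ioi (fun v ↦ by simp) (fun v u hu ↦ by
    simp only [mem_Ioi] at hu ⊢
    exact lt_asymm hu)
  have hIio := hpart Iio (fun v ↦ by simp) (fun v u hu ↦ by
    simp only [mem_Iio] at hu ⊢
    exact lt_asymm hu)
  have hθμ : 0 < θ * μ := by positivity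
  have hcmp : ∀ c, min ca d ≤ c → Real.exp (-(c * (θ * μ))) ≤
      Real.exp (-(min ca d * (θ * μ))) := fun c hc ↦
    Real.exp_le_exp.2 (neg_le_neg (mul_le_mul_of_nonneg_right hc hθμ.le))
  rw [starUpperTail, hΦ, ← hμ]
  calc _ ≤ (SimpleGraph.binomialRandom (Fin n) p).real
        ({G | (1 + η / 2) * μ ≤ #(lowStarPairs r (A * s) G)} ∪
          ({G | η / 2 ^ (r + 2) * μ ≤ ∑ v, truncPow r (A * s / 2) K (degreeIn Ioi G v)} ∪
          {G | η / 2 ^ (r + 2) * μ ≤ ∑ v, truncPow r (A * s / 2) K (degreeIn Iio G v)})) := by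
        refine measureReal_mono fun G hG ↦ ?_
        rw [hK]
        exact starCount_split hr hμ0.le hη hη1 G hG
    _ ≤ Real.exp (-(ca * (θ * μ))) + (Real.exp (-(d * (θ * μ))) + Real.exp (-(d * (θ * μ)))) := by
        refine (measureReal_union_le _ _).trans (add_le_add hlowstars ?_)
        exact (measureReal_union_le _ _).trans (add_le_add hIoi hIio)
    _ ≤ _ := by
        have h1 := hcmp ca (min_le_left _ _)
        have h2 := hcmp d (min_le_right _ _)
        linarith

/-- The upper bound for the upper tail. -/
theorem exists_mul_starRate_le_neg_log {r : ℕ} (hr : 2 ≤ r) {ε : ℝ} (hε : 0 < ε) :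
    ∃ c : ℝ, 0 < c ∧ ∀ (n : ℕ) (p : unitInterval), 0 < p → p < 1 →
      1 ≤ (1 + ε) * starMean r n p →
      starUpperTail r n p ((1 + ε) * starMean r n p) ≤ Real.exp (-(c * starRate r n p)) := by
  obtain ⟨c, hc, h⟩ := exists_upperTail_le_three_mul_exp hr (m := 1 / (1 + ε)) (η := min ε 1)
    (by positivity) (by rw [div_le_one (by positivity)]; linarith) (lt_min hε one_pos)
    (min_le_right _ _)
  have hlog : 0 < Real.log (1 + ε) := Real.log_pos (by linarith)
  refine ⟨min (c / 2) (Real.log (1 + ε) * c / 4), lt_min (by positivity) (by positivity),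
    fun n p hp hp1 hμ ↦ ?_⟩
  have hμ' : 1 / (1 + ε) ≤ starMean r n p := by
    rw [div_le_iff₀ (by positivity)]
    linarith
  have hμ0 : 0 < starMean r n p := lt_of_lt_of_le (by positivity) hμ'
  have hΦ0 : 0 ≤ starRate r n p := by
    rw [starRate]
    refine le_min hμ0.le (mul_nonneg (le_max_of_le_left (by positivity)) (Real.log_nonneg ?_))
    have hp0 : (0 : ℝ) < p := hp
    rw [le_div_iff₀ hp0, one_mul]
    exact p.2.2
  have h1 := h n p hp hp1 hμ'
  have h2 : starUpperTail r n p ((1 + ε) * starMean r n p) ≤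
      starUpperTail r n p ((1 + min ε 1) * starMean r n p) := by
    refine measureReal_mono fun G hG ↦ ?_
    rw [Set.mem_ofPred_eq] at hG ⊢
    refine le_trans ?_ hG
    gcongr
    exact min_le_left _ _
  -- If `cΦ ≥ 4`, the prefactor `3 ≤ e²` costs at most half of the exponent. If `Φ` is bounded,
  -- Markov's bound `1/(1+ε)` is enough.
  rcases le_total 4 (c * starRate r n p) with hbig | hsmall
  · refine (h2.trans h1).trans ?_
    have h3 : (3 : ℝ) ≤ Real.exp 2 := by linarith [Real.add_one_le_exp (2 : ℝ)]
    calc 3 * Real.exp (-(c * starRate r n p)) ≤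
        Real.exp 2 * Real.exp (-(c * starRate r n p)) := by gcongr
      _ = Real.exp (2 - c * starRate r n p) := by rw [← Real.exp_add]; congr 1
      _ ≤ _ := by
          refine Real.exp_le_exp.2 ?_
          have := mul_le_mul_of_nonneg_right
            (min_le_left (c / 2) (Real.log (1 + ε) * c / 4)) hΦ0
          linarith
  · have h3 : (1 + ε) * starMean r n p *
        starUpperTail r n p ((1 + ε) * starMean r n p) ≤ starMean r n p :=
      mul_meas_ge_le_integral_of_nonneg (.of_forall fun _ ↦ Nat.cast_nonneg _)
        Integrable.of_finite _
    have h4 : starUpperTail r n p ((1 + ε) * starMean r n p) ≤ Real.exp (-Real.log (1 + ε)) := by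
      rw [Real.exp_neg, Real.exp_log (by positivity), ← one_div, le_div_iff₀ (by positivity)]
      refine le_of_mul_le_mul_left ?_ hμ0
      linarith
    refine h4.trans (Real.exp_le_exp.2 ?_)
    have := mul_le_mul_of_nonneg_right
      (min_le_right (c / 2) (Real.log (1 + ε) * c / 4)) hΦ0
    have := mul_le_mul_of_nonneg_left hsmall hlog.le
    linarith

/-! ### Lower bound on the tail by planting edges. -/

open Finset in
/-- Planting stars gives a lower bound for the upper tail. -/
theorem pow_le_starUpperTail {r n : ℕ} (hr : 2 ≤ r) (p : unitInterval) (M : Finset (Fin n))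
    (U : Fin n → Finset (Fin n)) (hU : ∀ v ∈ M, v ∉ U v) {x : ℝ}
    (hx : x ≤ ((∑ v ∈ M, (#(U v)).choose r : ℕ) : ℝ)) :
    (p : ℝ) ^ (∑ v ∈ M, #(U v)) ≤ starUpperTail r n p x := by
  classical
  let S := M.biUnion fun v ↦ starEdges (v, U v)
  have hS : ∀ e ∈ S, ¬ e.IsDiag := by
    intro e he
    obtain ⟨v, hv, h⟩ := mem_biUnion.1 he
    obtain ⟨u, hu, rfl⟩ := mem_starEdges.1 h
    rw [Sym2.mk_isDiag_iff]
    rintro rfl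
    exact hU _ hv hu
  have hcard : #S ≤ ∑ v ∈ M, #(U v) := by
    refine card_biUnion_le.trans (le_of_eq ?_)
    simp [card_starEdges]
  refine (pow_le_pow_of_le_one p.2.1 p.2.2 hcard).trans ?_
  rw [← binomialRandom_real_subset p S hS, starUpperTail]
  refine measureReal_mono fun G hG ↦ ?_
  rw [Set.mem_ofPred_eq] at hG ⊢
  refine hx.trans (Nat.cast_le.2 ?_)
  rw [starCount_eq_sum hr]
  refine le_trans (sum_le_sum fun v hv ↦ ?_)
    (sum_le_sum_of_subset (f := fun v ↦ (G.degree v).choose r) (subset_univ M))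
  refine Nat.choose_le_choose r ?_
  rw [← SimpleGraph.card_neighborFinset_eq_degree]
  refine card_le_card fun u hu ↦ ?_
  rw [SimpleGraph.mem_neighborFinset]
  exact hG _ (mem_biUnion.2 ⟨v, hv, mem_starEdges.2 ⟨u, hu, rfl⟩⟩)

theorem pow_le_choose_mul_add (r t : ℕ) : t ^ r ≤ (r * t + r).choose r := by
  have h1 := Nat.pow_sub_le_descFactorial (r * t + r) r
  rw [Nat.descFactorial_eq_factorial_mul_choose] at h1
  have h2 : (r * t) ^ r ≤ (r * t + r + 1 - r) ^ r := Nat.pow_le_pow_left (by omega) r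
  have h3 : r.factorial ≤ r ^ r := Nat.factorial_le_pow r
  refine Nat.le_of_mul_le_mul_left ?_ (Nat.factorial_pos r)
  calc r.factorial * t ^ r ≤ r ^ r * t ^ r := Nat.mul_le_mul_right _ h3
    _ = (r * t) ^ r := (mul_pow r t r).symm
    _ ≤ _ := h2.trans h1

open Finset in
theorem exists_exp_neg_le_starUpperTail {r : ℕ} (hr : 2 ≤ r) {ε : ℝ} (hε : 0 < ε) :
    ∃ C : ℝ, 0 < C ∧ ∀ (n : ℕ) (p : unitInterval), 0 < p →
      1 ≤ (1 + ε) * starMean r n p →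
      (1 + ε) * starMean r n p ≤ (starCount r (⊤ : SimpleGraph (Fin n)) : ℝ) →
      Real.exp (-(C * (max (starMean r n p ^ (1 / (r : ℝ))) (starMean r n p / (n : ℝ) ^ (r - 1)) *
        Real.log (1 / (p : ℝ))))) ≤ starUpperTail r n p ((1 + ε) * starMean r n p) := by
  have hr2 : (2 : ℝ) ≤ r := by exact_mod_cast hr
  obtain ⟨κ, hκ⟩ : ∃ κ : ℝ, κ = 1 / ((r + 1 : ℝ) ^ r * r.factorial) := ⟨_, rfl⟩
  have hκ0 : 0 < κ := by rw [hκ]; positivity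
  have hC1 : 0 < 4 * r * (1 + ε) := by positivity
  have hC2 : 0 < (1 + ε) / κ := by positivity
  refine ⟨4 * r * (1 + ε) + (1 + ε) / κ, by positivity, fun n p hp hμ1 hμtop ↦ ?_⟩
  have hp0 : (0 : ℝ) < p := hp
  have hL0 : 0 ≤ Real.log (1 / (p : ℝ)) := by
    refine Real.log_nonneg ?_
    rw [le_div_iff₀ hp0, one_mul]
    exact p.2.2
  have hpow : ∀ e : ℕ, (p : ℝ) ^ e = Real.exp (-(e * Real.log (1 / (p : ℝ)))) := by
    intro e
    rw [one_div, Real.log_inv, mul_neg, neg_neg, Real.exp_nat_mul, Real.exp_log hp0]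
  obtain ⟨hn, -, -, -⟩ := starMean_bounds hr hp (m := 1 / (1 + ε)) (by positivity)
    (by rw [div_le_one (by positivity)]; linarith)
    (by rw [div_le_iff₀ (by positivity)]; linarith)
  have hchoose := pow_le_const_mul_choose_pred hn
  rw [← hκ] at hchoose
  obtain ⟨μ, hμ⟩ : ∃ μ, μ = starMean r n p := ⟨_, rfl⟩
  rw [starCount_top hr] at hμtop
  rw [← hμ] at hμ1 hμtop ⊢
  have hμ0 : 0 < μ := by
    by_contra! h
    nlinarith
  have hn0 : 0 < n := by omega
  have hn0' : (0 : ℝ) < n := by exact_mod_cast hn0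
  suffices h : ∃ e : ℕ, (p : ℝ) ^ e ≤ starUpperTail r n p ((1 + ε) * μ) ∧
      (e : ℝ) ≤ (4 * r * (1 + ε) + (1 + ε) / κ) *
        max (μ ^ (1 / (r : ℝ))) (μ / (n : ℝ) ^ (r - 1)) by
    obtain ⟨e, h1, h2⟩ := h
    refine le_trans ?_ h1
    rw [hpow]
    refine Real.exp_le_exp.2 (neg_le_neg ?_)
    rw [← mul_assoc]
    exact mul_le_mul_of_nonneg_right h2 hL0
  obtain ⟨x, hx⟩ : ∃ x, x = ((1 + ε) * μ) ^ ((r : ℝ)⁻¹) := ⟨_, rfl⟩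
  have hx1 : 1 ≤ x := hx ▸ Real.one_le_rpow hμ1 (by positivity)
  have hxr : x ^ r = (1 + ε) * μ := hx ▸ Real.rpow_inv_natCast_pow (by positivity) (by omega)
  have hxμ : x ≤ (1 + ε) * μ ^ (1 / (r : ℝ)) := by
    rw [hx, Real.mul_rpow (by positivity) hμ0.le, one_div]
    gcongr
    refine Real.rpow_le_self_of_one_le (by linarith) ?_
    rw [inv_le_one₀ (by positivity)]
    linarith
  obtain ⟨t, ht⟩ : ∃ t, t = ⌈x⌉₊ := ⟨_, rfl⟩
  have hxt : x ≤ t := ht ▸ Nat.le_ceil x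
  have htx : (t : ℝ) ≤ 2 * x := by
    rw [ht]
    have := Nat.ceil_lt_add_one (by linarith : 0 ≤ x)
    linarith
  have hs : ((r * t + r : ℕ) : ℝ) ≤ 4 * r * (1 + ε) * μ ^ (1 / (r : ℝ)) := by
    push_cast
    have h1 : (r : ℝ) * t + r ≤ r * (4 * x) := by nlinarith
    nlinarith
  have hroot : 0 < μ ^ (1 / (r : ℝ)) := Real.rpow_pos_of_pos hμ0 _
  -- Either one vertex can have the `O(μ^{1/r})` neighbours that give `(1+ε)μ` stars, or `n =
  -- O(μ^{1/r})` and `m` vertices are joined to everything.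
  rcases Nat.lt_or_ge (r * t + r) n with hsn | hsn
  · refine ⟨r * t + r, ?_, ?_⟩
    · obtain ⟨U, hU, hUc⟩ := exists_subset_card_eq (s := univ.erase (⟨0, hn0⟩ : Fin n))
        (n := r * t + r) (by rw [card_erase_of_mem (mem_univ _), card_univ, Fintype.card_fin]; omega)
      have h1 := pow_le_starUpperTail hr p {(⟨0, hn0⟩ : Fin n)} (fun _ ↦ U) (x := (1 + ε) * μ)
        (by
          intro v hv h
          rw [mem_singleton.1 hv] at h
          exact notMem_erase _ _ (hU h))
        (by
          rw [sum_singleton, hUc, ← hxr]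
          refine (pow_le_pow_left₀ (by linarith) hxt r).trans ?_
          exact_mod_cast pow_le_choose_mul_add r t)
      rwa [sum_singleton, hUc] at h1
    · refine hs.trans ?_
      have := le_max_left (μ ^ (1 / (r : ℝ))) (μ / (n : ℝ) ^ (r - 1))
      nlinarith
  · have hnc : 0 < (n - 1).choose r := Nat.choose_pos (by omega)
    have hnc' : (0 : ℝ) < (n - 1).choose r := by exact_mod_cast hnc
    obtain ⟨m, hm⟩ : ∃ m, m = ⌈(1 + ε) * μ / (n - 1).choose r⌉₊ := ⟨_, rfl⟩
    have hm1 : (1 + ε) * μ ≤ m * (n - 1).choose r := by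
      rw [← div_le_iff₀ hnc', hm]
      exact Nat.le_ceil _
    have hm2 : (m : ℝ) ≤ (1 + ε) * μ / (n - 1).choose r + 1 := by
      rw [hm]
      exact (Nat.ceil_lt_add_one (by positivity)).le
    -- Enough vertices exist precisely because `(1+ε)μ` is at most the star count of the complete
    -- graph.
    have hmn : m ≤ n := by
      rw [hm, Nat.ceil_le, div_le_iff₀ hnc']
      exact_mod_cast hμtop
    obtain ⟨M, -, hM⟩ := exists_subset_card_eq (s := (univ : Finset (Fin n))) (n := m)
      (by simpa using hmn)
    have hUc : ∀ v : Fin n, #(univ.erase v) = n - 1 := fun v ↦ by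
      rw [card_erase_of_mem (mem_univ _), card_univ, Fintype.card_fin]
    refine ⟨m * (n - 1), ?_, ?_⟩
    · have h1 := pow_le_starUpperTail hr p M (fun v ↦ univ.erase v) (x := (1 + ε) * μ)
        (fun v _ ↦ notMem_erase _ _)
        (by
          simp only [hUc, sum_const, hM, smul_eq_mul]
          exact_mod_cast hm1)
      simpa only [hUc, sum_const, hM, smul_eq_mul] using h1
    · have h1 : (n : ℝ) ≤ 4 * r * (1 + ε) * μ ^ (1 / (r : ℝ)) :=
        le_trans (by exact_mod_cast hsn) hs
      have h2 : (n : ℝ) * ((1 + ε) * μ / (n - 1).choose r) ≤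
          (1 + ε) / κ * (μ / (n : ℝ) ^ (r - 1)) := by
        have h3 : (1 + ε) * μ / (n - 1).choose r ≤ (1 + ε) * μ / (κ * (n : ℝ) ^ r) := by gcongr
        refine (mul_le_mul_of_nonneg_left h3 hn0'.le).trans (le_of_eq ?_)
        rw [show (n : ℝ) ^ r = n ^ (r - 1) * n by rw [← pow_succ]; congr 1; omega]
        field_simp
      have h4 : ((m * (n - 1) : ℕ) : ℝ) ≤ m * n := by
        exact_mod_cast Nat.mul_le_mul_left m (Nat.sub_le n 1)
      -- The main term is of order `μ / n^{r-1}`; the `n` from rounding up is `O(μ^{1/r})` by `h1`.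
      have h5 : (m : ℝ) * n ≤ n * ((1 + ε) * μ / (n - 1).choose r) + n := by nlinarith
      have h6 := mul_le_mul_of_nonneg_left
        (le_max_left (μ ^ (1 / (r : ℝ))) (μ / (n : ℝ) ^ (r - 1))) hC1.le
      have h7 := mul_le_mul_of_nonneg_left
        (le_max_right (μ ^ (1 / (r : ℝ))) (μ / (n : ℝ) ^ (r - 1))) hC2.le
      rw [add_mul]
      linarith

/-! ### Lower bound on the tail in the sparse range. -/

theorem infinitePi_real_exists {κ Ω : Type*} [Fintype κ] [MeasurableSpace Ω] (ν : Measure Ω)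
    [IsProbabilityMeasure ν] {E : Set Ω} (hE : MeasurableSet E) :
    (Measure.infinitePi fun _ : κ ↦ ν).real {η | ∃ i, η i ∈ E} =
      1 - (1 - ν.real E) ^ Fintype.card κ := by
  have h : {η : κ → Ω | ∃ i, η i ∈ E} = (Set.pi (Finset.univ : Finset κ) fun _ ↦ Eᶜ)ᶜ := by
    ext η
    simp
  rw [h, probReal_compl_eq_one_sub (.pi (Set.to_countable _) fun _ _ ↦ hE.compl), measureReal_def,
    Measure.infinitePi_pi _ fun _ _ ↦ hE.compl]
  simp [← measureReal_def, probReal_compl_eq_one_sub hE]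

theorem infinitePi_real_forall_exists {ι κ Ω : Type*} [Fintype ι] [Fintype κ] [MeasurableSpace Ω]
    (ν : Measure Ω) [IsProbabilityMeasure ν] {E : Set Ω} (hE : MeasurableSet E) :
    (Measure.infinitePi fun _ : ι × κ ↦ ν).real {ω | ∀ j, ∃ i, ω (j, i) ∈ E} =
      (1 - (1 - ν.real E) ^ Fintype.card κ) ^ Fintype.card ι := by
  have hE' : MeasurableSet {η : κ → Ω | ∃ i, η i ∈ E} := by
    rw [show {η : κ → Ω | ∃ i, η i ∈ E} = ⋃ i, (fun η ↦ η i) ⁻¹' E by ext; simp]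
    exact .iUnion fun i ↦ measurable_pi_apply i hE
  have h : {ω : ι × κ → Ω | ∀ j, ∃ i, ω (j, i) ∈ E} =
      MeasurableEquiv.curry ι κ Ω ⁻¹'
        (Set.pi (Finset.univ : Finset ι) fun _ ↦ {η | ∃ i, η i ∈ E}) := by
    ext ω
    simp
  rw [← infinitePi_real_exists ν hE, h, measureReal_def,
    ← Measure.map_apply (MeasurableEquiv.measurable _)
      (.pi (Set.to_countable _) fun _ _ ↦ hE'),
    Measure.infinitePi_map_curry fun _ _ ↦ ν, Measure.infinitePi_pi _ fun _ _ ↦ hE']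
  simp [measureReal_def]

/-- The probability that each of `k` groups of `a` vertices has a vertex with a neighbour in each
of `r` further groups of `b` vertices is a lower bound for the probability of `k` stars. -/
theorem forall_exists_le_starUpperTail {r n k a b : ℕ} (hr : 2 ≤ r) (p : unitInterval)
    (hn : k * a + r * b ≤ n) :
    (1 - (1 - (1 - (1 - (p : ℝ)) ^ b) ^ r) ^ a) ^ k ≤ starUpperTail r n p k := by
  classical
  obtain ⟨f⟩ : Nonempty ((Fin k × Fin a) ⊕ (Fin r × Fin b) ↪ Fin n) := by
    refine Function.Embedding.nonempty_of_card_le ?_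
    simpa using hn
  let e : (Fin k × Fin a) × (Fin r × Fin b) → Sym2 (Fin n) := fun x ↦
    s(f (.inl x.1), f (.inr x.2))
  have he : Function.Injective e := by
    rintro ⟨x, y⟩ ⟨x', y'⟩ h
    rcases Sym2.eq_iff.1 h with ⟨h1, h2⟩ | ⟨h1, h2⟩
    · exact Prod.ext (Sum.inl_injective (f.injective h1)) (Sum.inr_injective (f.injective h2))
    · exact absurd (f.injective h1) (by simp)
  have hd : ∀ x, ¬ (e x).IsDiag := by
    intro x
    rw [Sym2.mk_isDiag_iff]
    intro h
    exact absurd (f.injective h) (by simp)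
  let E : Set (Fin r × Fin b → Prop) := {η | ∀ l, ∃ m, η (l, m) ∈ ({True} : Set Prop)}
  let T : Set ((Fin k × Fin a) × (Fin r × Fin b) → Prop) :=
    {ω | ∀ j, ∃ i, (fun y ↦ ω ((j, i), y)) ∈ E}
  have hE : MeasurableSet E := (Set.toFinite E).measurableSet
  have hT : MeasurableSet T := (Set.toFinite T).measurableSet
  have hB : (bernoulliProp p).real {True} = p := by
    simp [measureReal_def, bernoulliProp_true]
  have hprob : (Measure.infinitePi fun _ : (Fin k × Fin a) × (Fin r × Fin b) ↦
      bernoulliProp p).real T = (1 - (1 - (1 - (1 - (p : ℝ)) ^ b) ^ r) ^ a) ^ k := by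
    -- The same formula is used on two levels: over groups of centres here, and over the leaf groups
    -- of a fixed centre in `h2`.
    have h1 := infinitePi_real_forall_exists (ι := Fin k) (κ := Fin a)
      (Measure.infinitePi fun _ : Fin r × Fin b ↦ bernoulliProp p) hE
    have h2 := infinitePi_real_forall_exists (ι := Fin r) (κ := Fin b)
      (bernoulliProp p) (measurableSet_singleton True)
    rw [h2, hB] at h1
    simp only [Fintype.card_fin] at h1
    rw [← h1, measureReal_def, measureReal_def,
      ← Measure.infinitePi_map_curry fun _ _ ↦ bernoulliProp p,
      Measure.map_apply (MeasurableEquiv.measurable _) (Set.toFinite _).measurableSet]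
    rfl
  have hm : Measurable (fun (G : SimpleGraph (Fin n)) x ↦ e x ∈ G.edgeSet) :=
    measurable_pi_iff.2 fun x ↦ (measurable_set_iff.1 SimpleGraph.measurable_edgeSet) (e x)
  rw [← hprob, ← map_mem_edgeSet_binomialRandom p he hd, map_measureReal_apply hm hT, starUpperTail]
  refine measureReal_mono fun G hG ↦ ?_
  have hG' : ∀ j, ∃ i, ∀ l, ∃ m, e ((j, i), (l, m)) ∈ G.edgeSet := by
    simpa [T, E] using hG
  choose i hi using hG'
  choose m hm' using hi
  rw [Set.mem_ofPred_eq, Nat.cast_le, starCount_eq_sum hr]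
  let M : Finset (Fin n) := Finset.univ.image fun j ↦ f (.inl (j, i j))
  have hM : M.card = k := by
    rw [Finset.card_image_of_injective, Finset.card_univ, Fintype.card_fin]
    intro j j' h
    exact congrArg Prod.fst (Sum.inl_injective (f.injective h))
  have hdeg : ∀ v ∈ M, 1 ≤ (G.degree v).choose r := by
    intro v hv
    obtain ⟨j, -, rfl⟩ := Finset.mem_image.1 hv
    refine Nat.choose_pos ?_
    rw [← SimpleGraph.card_neighborFinset_eq_degree]
    have hU : (Finset.univ.image fun l ↦ f (.inr (l, m j l))).card = r := by
      rw [Finset.card_image_of_injective, Finset.card_univ, Fintype.card_fin]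
      intro l l' h
      exact congrArg Prod.fst (Sum.inr_injective (f.injective h))
    refine hU.symm.le.trans (Finset.card_le_card fun u hu ↦ ?_)
    obtain ⟨l, -, rfl⟩ := Finset.mem_image.1 hu
    rw [SimpleGraph.mem_neighborFinset]
    exact hm' j l
  calc k = ∑ _v ∈ M, 1 := by simp [hM]
    _ ≤ ∑ v ∈ M, (G.degree v).choose r := Finset.sum_le_sum hdeg
    _ ≤ _ := Finset.sum_le_sum_of_subset (Finset.subset_univ M)

theorem div_two_le_one_sub_one_sub_pow {p x : ℝ} {b : ℕ} (hp1 : p ≤ 1) (hx0 : 0 ≤ x)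
    (hx1 : x ≤ 1) (hx : x ≤ p * b) : x / 2 ≤ 1 - (1 - p) ^ b := by
  have h1 : (1 - p) ^ b ≤ Real.exp (-x) := by
    calc (1 - p) ^ b ≤ Real.exp (-p) ^ b :=
          pow_le_pow_left₀ (by linarith) (Real.one_sub_le_exp_neg p) b
      _ = Real.exp (b * -p) := by rw [Real.exp_nat_mul]
      _ ≤ _ := Real.exp_le_exp.2 (by linarith)
  have h2 : Real.exp (-x) ≤ 1 - x / 2 := by
    rw [Real.exp_neg, inv_le_comm₀ (Real.exp_pos _) (by linarith)]
    have h3 : 1 + x ≤ Real.exp x := by linarith [Real.add_one_le_exp x]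
    refine le_trans ?_ h3
    rw [inv_le_iff_one_le_mul₀ (by linarith)]
    nlinarith
  linarith

theorem div_two_le_natDiv {m d : ℕ} (hd : 0 < d) (h : d ≤ m) :
    (m : ℝ) / (2 * d) ≤ (m / d : ℕ) := by
  have h1 : 1 ≤ m / d := (Nat.one_le_div_iff hd).2 h
  have h2 : m < d * (m / d + 1) := Nat.lt_mul_div_succ m hd
  have h3 : m ≤ (m / d) * (2 * d) := by nlinarith
  have hd' : (0 : ℝ) < d := by exact_mod_cast hd
  rw [div_le_iff₀ (by positivity)]
  exact_mod_cast h3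

/-- Half of the vertices form `k`, about `(1+ε)μ`, groups of possible centres; the other half form
`r` leaf groups. A centre sees all leaf groups with probability of order at least `(np)^r`, and a
group has about `n/k` centres with `n(np)^r / k` bounded below. So each group succeeds with
probability bounded below, and all `k` do with probability `exp(-O(μ))`. -/
theorem exists_exp_neg_starMean_le_starUpperTail {r : ℕ} (hr : 2 ≤ r) {ε : ℝ} (hε : 0 < ε) :
    ∃ δ C : ℝ, 0 < δ ∧ 0 < C ∧ ∀ (n : ℕ) (p : unitInterval), 0 < p →
      1 ≤ (1 + ε) * starMean r n p → n * (p : ℝ) ≤ δ →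
      Real.exp (-(C * starMean r n p)) ≤ starUpperTail r n p ((1 + ε) * starMean r n p) := by
  have hr2 : (2 : ℝ) ≤ r := by exact_mod_cast hr
  obtain ⟨z, hz⟩ : ∃ z : ℝ, z = 1 / (8 * (1 + ε) * (8 * r : ℝ) ^ r) := ⟨_, rfl⟩
  have hz0 : 0 < z := by rw [hz]; positivity
  have hez : Real.exp (-z) < 1 := by rw [Real.exp_lt_one_iff]; linarith
  have hw0 : 0 < -Real.log (1 - Real.exp (-z)) := by
    have h1 := Real.exp_pos (-z)
    have := Real.log_neg (by linarith : 0 < 1 - Real.exp (-z)) (by linarith)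
    linarith
  refine ⟨1 / (4 * r * (1 + ε)), 2 * (1 + ε) * -Real.log (1 - Real.exp (-z)), by positivity,
    by positivity, fun n p hp hμ1 hnp ↦ ?_⟩
  have hp0 : (0 : ℝ) < p := hp
  obtain ⟨hn, -, hup, -⟩ := starMean_bounds hr hp (m := 1 / (1 + ε)) (by positivity)
    (by rw [div_le_one (by positivity)]; linarith)
    (by rw [div_le_iff₀ (by positivity)]; linarith)
  obtain ⟨μ, hμ⟩ : ∃ μ, μ = starMean r n p := ⟨_, rfl⟩
  rw [← hμ] at hμ1 hup ⊢
  have hμ0 : 0 < μ := by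
    by_contra! h
    nlinarith
  have hn0 : 0 < n := by omega
  have hn0' : (0 : ℝ) < n := by exact_mod_cast hn0
  have hN : (0 : ℝ) < n * p := by positivity
  have hδ1 : 1 / (4 * r * (1 + ε)) ≤ 1 := by
    rw [div_le_one (by positivity)]
    nlinarith
  have hNr : (n * p : ℝ) ^ r ≤ 1 / (4 * r * (1 + ε)) :=
    (pow_le_of_le_one hN.le (hnp.trans hδ1) (by omega)).trans hnp
  have hμn : (1 + ε) * μ * (4 * r) ≤ n := by
    have h1 : μ ≤ n * (1 / (4 * r * (1 + ε))) :=
      hup.trans (mul_le_mul_of_nonneg_left hNr hn0'.le)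
    rw [mul_one_div, le_div_iff₀ (by positivity)] at h1
    linarith
  obtain ⟨k, hk⟩ : ∃ k, k = ⌈(1 + ε) * μ⌉₊ := ⟨_, rfl⟩
  have hk1 : (1 + ε) * μ ≤ k := hk ▸ Nat.le_ceil _
  have hk2 : (k : ℝ) ≤ 2 * ((1 + ε) * μ) := by
    rw [hk]
    have := Nat.ceil_lt_add_one (by linarith : 0 ≤ (1 + ε) * μ)
    linarith
  have hk0' : (0 : ℝ) < k := by linarith
  have hk0 : 0 < k := by exact_mod_cast hk0'
  have hkn : 2 * k ≤ n := by
    have : ((2 * k : ℕ) : ℝ) ≤ n := by push_cast; nlinarith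
    exact_mod_cast this
  have hrn : 2 * r ≤ n := by
    have : ((2 * r : ℕ) : ℝ) ≤ n := by push_cast; nlinarith
    exact_mod_cast this
  obtain ⟨a, ha⟩ : ∃ a, a = n / (2 * k) := ⟨_, rfl⟩
  obtain ⟨b, hb⟩ : ∃ b, b = n / (2 * r) := ⟨_, rfl⟩
  have ha1 : (n : ℝ) / (4 * k) ≤ a := by
    have := div_two_le_natDiv (by omega : 0 < 2 * k) hkn
    rw [← ha] at this
    push_cast at this
    refine le_trans (le_of_eq ?_) this
    ring
  have hb1 : (n : ℝ) / (4 * r) ≤ b := by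
    have := div_two_le_natDiv (by omega : 0 < 2 * r) hrn
    rw [← hb] at this
    push_cast at this
    refine le_trans (le_of_eq ?_) this
    ring
  have hsum : k * a + r * b ≤ n := by
    have h1 : a * (2 * k) ≤ n := ha ▸ Nat.div_mul_le_self n (2 * k)
    have h2 : b * (2 * r) ≤ n := hb ▸ Nat.div_mul_le_self n (2 * r)
    nlinarith
  have hstar : 1 - (1 - (p : ℝ)) ^ b ≥ n * p / (8 * r) := by
    have h1 := div_two_le_one_sub_one_sub_pow (p := p) (x := n * p / (4 * r)) (b := b) p.2.2
      (by positivity)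
      (by
        rw [div_le_one (by positivity)]
        linarith)
      (by
        calc (n * p / (4 * r) : ℝ) = p * ((n : ℝ) / (4 * r)) := by ring
          _ ≤ _ := by gcongr)
    refine le_trans (le_of_eq ?_) h1
    ring
  obtain ⟨q, hq⟩ : ∃ q, q = (1 - (1 - (p : ℝ)) ^ b) ^ r := ⟨_, rfl⟩
  have hq1 : (n * p / (8 * r) : ℝ) ^ r ≤ q := hq ▸ pow_le_pow_left₀ (by positivity) hstar r
  have hqle : q ≤ 1 := by
    rw [hq]
    have h1 : 0 ≤ (1 - (p : ℝ)) ^ b := pow_nonneg (by linarith [p.2.2]) b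
    refine pow_le_one₀ (le_trans (by positivity) hstar) (by linarith)
  have hq0 : 0 ≤ q := le_trans (by positivity) hq1
  -- `z` results from `q ≥ (np/(8r))^r`, `a ≥ n/(4k)` and `k ≤ 2(1+ε)μ ≤ 2(1+ε)n(np)^r`.
  have hza : z ≤ q * a := by
    calc z ≤ (n * p / (8 * r) : ℝ) ^ r * (n / (4 * k)) := by
          rw [hz, div_pow, div_mul_div_comm, div_le_div_iff₀ (by positivity) (by positivity), one_mul]
          have h1 : (k : ℝ) ≤ 2 * (1 + ε) * (n * (n * p) ^ r) := by nlinarith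
          have h2 : (0 : ℝ) < (8 * r) ^ r := by positivity
          nlinarith
      _ ≤ _ := by gcongr
  have hgroup : 1 - Real.exp (-z) ≤ 1 - (1 - q) ^ a := by
    have h1 : (1 - q) ^ a ≤ Real.exp (-z) := by
      calc (1 - q) ^ a ≤ Real.exp (-q) ^ a :=
            pow_le_pow_left₀ (by linarith) (Real.one_sub_le_exp_neg q) a
        _ = Real.exp (a * -q) := by rw [Real.exp_nat_mul]
        _ ≤ _ := Real.exp_le_exp.2 (by linarith)
    linarith
  have hmain := forall_exists_le_starUpperTail hr p hsum
  rw [← hq] at hmain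
  have hmono : starUpperTail r n p k ≤ starUpperTail r n p ((1 + ε) * μ) :=
    measureReal_mono fun G hG ↦ hk1.trans hG
  refine le_trans ?_ (hmain.trans hmono)
  refine le_trans ?_ (pow_le_pow_left₀ (by linarith) hgroup k)
  calc Real.exp (-(2 * (1 + ε) * -Real.log (1 - Real.exp (-z)) * μ))
      ≤ Real.exp (k * Real.log (1 - Real.exp (-z))) := Real.exp_le_exp.2 (by nlinarith)
    _ = (1 - Real.exp (-z)) ^ k := by
        rw [Real.exp_nat_mul, Real.exp_log (by linarith)]

/-! ### The dense range and the conclusion. -/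

/-- `mul_pow_le_of_scale` with `θ = L / K^{r-1}` bounds `θ(np)^{r-1}`, hence `θ` itself once `np ≥
δ`. -/
theorem mul_log_le_const_mul_starMean {r : ℕ} (hr : 2 ≤ r) {ε δ : ℝ} (hε : 0 < ε) (hδ : 0 < δ) :
    ∃ B : ℝ, 0 < B ∧ ∀ (n : ℕ) (p : unitInterval), 0 < p →
      1 ≤ (1 + ε) * starMean r n p → δ ≤ n * (p : ℝ) →
      max (starMean r n p ^ (1 / (r : ℝ))) (starMean r n p / (n : ℝ) ^ (r - 1)) *
        Real.log (1 / (p : ℝ)) ≤ B * starMean r n p := by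
  have hr2 : (2 : ℝ) ≤ r := by exact_mod_cast hr
  obtain ⟨κ, hκ⟩ : ∃ κ : ℝ, κ = 1 / ((r + 1 : ℝ) ^ r * r.factorial) := ⟨_, rfl⟩
  have hκ0 : 0 < κ := by rw [hκ]; positivity
  have hκ1 : κ ≤ 1 := by
    rw [hκ, div_le_one (by positivity)]
    exact one_le_mul_of_one_le_of_one_le (one_le_pow₀ (by linarith))
      (by exact_mod_cast Nat.succ_le_of_lt (Nat.factorial_pos r))
  obtain ⟨m, hm⟩ : ∃ m, m = 1 / (1 + ε) := ⟨_, rfl⟩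
  have hm0 : 0 < m := by rw [hm]; positivity
  have hm1 : m ≤ 1 := by
    rw [hm, div_le_one (by positivity)]
    linarith
  refine ⟨1 / (1 / (2 * r) * (κ * m) ^ (r - 1)) / δ ^ (r - 1), by positivity,
    fun n p hp hμ1 hδn ↦ ?_⟩
  have hp0 : (0 : ℝ) < p := hp
  have hμm : m ≤ starMean r n p := by
    rw [hm, div_le_iff₀ (by positivity)]
    linarith
  have hμ0 : 0 < starMean r n p := hm0.trans_le hμm
  obtain ⟨hn, hnp, -, hlow⟩ := starMean_bounds hr hp hm0 hm1 hμm
  rw [← hκ] at hlow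
  have hn0 : (0 : ℝ) < n := by
    have : 0 < n := by omega
    exact_mod_cast this
  have hN : (0 : ℝ) < n * p := by positivity
  have hL0 : 0 ≤ Real.log (1 / (p : ℝ)) := by
    refine Real.log_nonneg ?_
    rw [le_div_iff₀ hp0, one_mul]
    exact p.2.2
  have hK := scale_lower_bound (by omega) hκ0 hκ1 hm0 hm1 hp0 p.2.2 hn0 hlow hnp
  have hK' : κ * m * (n * p) * Real.exp (1 / (2 * r) * Real.log (1 / (p : ℝ))) ≤
      min (starMean r n p ^ (1 / (r : ℝ))) n := by
    refine le_trans (le_of_eq ?_) hK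
    congr 2
    ring
  have h1 := mul_pow_le_of_scale hr (by positivity) (by positivity) hL0 hN hK' le_rfl
  have h2 : δ ^ (r - 1) ≤ (n * p : ℝ) ^ (r - 1) := by gcongr
  have hK0 : 0 < min (starMean r n p ^ (1 / (r : ℝ))) n :=
    lt_min (Real.rpow_pos_of_pos hμ0 _) hn0
  rw [max_eq_div_min_pow hr hμ0 hn0, div_mul_eq_mul_div, mul_div_assoc, mul_comm]
  refine mul_le_mul_of_nonneg_right ?_ hμ0.le
  rw [le_div_iff₀ (by positivity)]
  refine le_trans ?_ h1
  gcongr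

theorem theorem1 (r : ℕ) (hr : 2 ≤ r) (ε : ℝ) (hε : 0 < ε) :
    ∃ c C : ℝ, 0 < c ∧ 0 < C ∧
      ∀ (n : ℕ) (p : unitInterval), 0 < p →
        1 ≤ (1 + ε) * starMean r n p →
        (1 + ε) * starMean r n p ≤ (starCount r (⊤ : SimpleGraph (Fin n)) : ℝ) →
          0 < starUpperTail r n p ((1 + ε) * starMean r n p) ∧
          c * starRate r n p ≤ -Real.log (starUpperTail r n p ((1 + ε) * starMean r n p)) ∧
          -Real.log (starUpperTail r n p ((1 + ε) * starMean r n p)) ≤ C * starRate r n p := by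
  obtain ⟨c, hc, hupper⟩ := exists_mul_starRate_le_neg_log hr hε
  obtain ⟨C₁, hC₁, hplant⟩ := exists_exp_neg_le_starUpperTail hr hε
  obtain ⟨δ, C₂, hδ, hC₂, hsparse⟩ := exists_exp_neg_starMean_le_starUpperTail hr hε
  obtain ⟨B, hB, hdense⟩ := mul_log_le_const_mul_starMean hr hε hδ
  refine ⟨c, C₁ * (1 + B) + C₂, hc, by positivity, fun n p hp hμ1 hμtop ↦ ?_⟩
  have hμ0 : 0 < starMean r n p := by
    by_contra! h
    nlinarith
  -- At `p = 1` the mean is the maximal count, which `(1+ε)μ` would exceed.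
  have hp1 : p < 1 := by
    refine lt_of_le_of_ne p.2.2 fun h ↦ ?_
    have h1 := starMean_eq hr n p
    rw [h] at h1 hμtop hμ0
    simp only [Set.Icc.coe_one, one_pow, mul_one] at h1
    rw [← h1, ← h] at hμtop
    rw [← h] at hμ0
    nlinarith
  have hplant' := hplant n p hp hμ1 hμtop
  have hpos := (Real.exp_pos _).trans_le hplant'
  refine ⟨hpos, ?_, ?_⟩
  · have := Real.log_le_log hpos (hupper n p hp hp1 hμ1)
    rw [Real.log_exp] at this
    linarith
  · have hlog1 := Real.log_le_log (Real.exp_pos _) hplant'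
    rw [Real.log_exp] at hlog1
    obtain ⟨Q, hQ⟩ : ∃ Q, Q = max (starMean r n p ^ (1 / (r : ℝ)))
      (starMean r n p / (n : ℝ) ^ (r - 1)) * Real.log (1 / (p : ℝ)) := ⟨_, rfl⟩
    rw [← hQ] at hlog1
    have hQ0 : 0 ≤ Q := by
      have hp0 : (0 : ℝ) < p := hp
      rw [hQ]
      refine mul_nonneg (le_max_of_le_left (by positivity)) (Real.log_nonneg ?_)
      rw [le_div_iff₀ hp0, one_mul]
      exact p.2.2
    rw [show starRate r n p = min (starMean r n p) Q by rw [hQ]; rfl]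
    have hmin0 : 0 ≤ min (starMean r n p) Q := le_min hμ0.le hQ0
    rcases le_total (n * (p : ℝ)) δ with h | h
    · have hlog2 := Real.log_le_log (Real.exp_pos _) (hsparse n p hp hμ1 h)
      rw [Real.log_exp] at hlog2
      rcases min_cases (starMean r n p) Q with ⟨h1, -⟩ | ⟨h1, -⟩ <;> rw [h1] at hmin0 ⊢
      · have : 0 ≤ C₁ * (1 + B) * starMean r n p := by positivity
        linarith
      · have h2 : 0 ≤ C₁ * B * Q := by positivity
        have h3 : 0 ≤ C₂ * Q := by positivity
        linarith
    · have hd := hdense n p hp hμ1 h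
      rw [← hQ] at hd
      have h1 : Q ≤ (1 + B) * min (starMean r n p) Q := by
        rcases min_cases (starMean r n p) Q with ⟨h1, -⟩ | ⟨h1, -⟩ <;> rw [h1]
        · linarith
        · nlinarith
      have h2 := mul_le_mul_of_nonneg_left h1 hC₁.le
      have h3 : 0 ≤ C₂ * min (starMean r n p) Q := by positivity
      linarith
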